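/- Let $k$ be an algebraically closed field of characteristic zero, $G$ a group, $a\in Z(G)$, and let $\hat G$ be the group of characters $G\to k^\times$. Let $\chi\in\hat G$ with $\chi(a)\neq 1$. Let $H=kG(\chi^{-1},a,0)$ be the Hopf-Ore extension: the algebra generated by $G$ and an element $x$ subject to $xg=\chi^{-1}(g)gx$ for $g\in G$, with $\Delta(g)=g\otimes g$, $\Delta(x)=x\otimes a+1\otimes x$, $\varepsilon(g)=1$, $\varepsilon(x)=0$. For $\mu\in\hat G$ and $m\ge 1$ let $V_m(\mu)$ be the $H$-module with $k$-basis $m_0,\dots,m_{m-1}$ and action $g\cdot m_i=\chi^i(g)\mu(g)m_i$, $x\cdot m_i=m_{i+1}$ for $i\le m-2$, $x\cdot m_{m-1}=0$. Tensor products of $H$-modules are taken over $k$, with $H$ acting through $\Delta$. A direct sum over an empty range is $0$. Assume that $\chi$ has finite order $s$ and that $q=\chi^{-1}(a)$ is a primitive $s$-th root of unity. Let $\lambda,\sigma\in\hat G$, let $n\ge t\ge 1$ be integers, and write $n=r's+l'$ and $t=rs+l$ with $0\le l,l'\le s-1$. Then $V_n(\lambda)\otimes V_t(\sigma)\cong V_t(\sigma)\otimes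 V_n(\lambda)$ as $H$-modules, and both are isomorphic to the following direct sums. (1) Suppose $l+l'\le s$. If $l\le l'$, the sum is $$\begin{aligned}&\bigoplus_{i=0}^{r}\bigoplus_{0\le j\le l-1}V_{n+t-1-2is-2j}(\chi^j\lambda\sigma)\ \oplus\bigoplus_{0\le i\le r-1}\bigoplus_{l\le j\le l'-1}V_{(r+r'-2i)s}(\chi^j\lambda\sigma)\\ &\oplus\bigoplus_{0\le i\le r-1}\bigoplus_{l'\le j\le l+l'-1}V_{n+t-1-2is-2j}(\chi^j\lambda\sigma)\ \oplus\bigoplus_{0\le i\le r-1}\bigoplus_{l+l'\le j\le s-1}V_{(r+r'-1-2i)s}(\chi^j\lambda\sigma),\end{aligned}$$ and if $l\ge l'$, it is $$\begin{aligned}&\bigoplus_{i=0}^{r}\bigoplus_{0\le j\le l'-1}V_{n+t-1-2is-2j}(\chi^j\lambda\sigma)\ \oplus\bigoplus_{i=0}^{r}\bigoplus_{l'\le j\le l-1}V_{(r+r'-2i)s}(\chi^j\lambda\sigma)\\ &\oplus\bigoplus_{0\le i\le r-1}\bigoplus_{l\le j\le l+l'-1}V_{n+t-1-2is-2j}(\chi^j\lambda\sigma)\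 \oplus\bigoplus_{0\le i\le r-1}\bigoplus_{l+l'\le j\le s-1}V_{(r+r'-1-2i)s}(\chi^j\lambda\sigma).\end{aligned}$$ (2) Suppose $l+l'\ge s+1$ and let $m=l+l'-s-1$. If $l\le l'$, the sum is $$\begin{aligned}&\bigoplus_{i=0}^{r}\bigoplus_{j=0}^{m}V_{(r+r'+1-2i)s}(\chi^j\lambda\sigma)\ \oplus\bigoplus_{i=0}^{r}\bigoplus_{m+1\le j\le l-1}V_{n+t-1-2is-2j}(\chi^j\lambda\sigma)\\ &\oplus\bigoplus_{0\le i\le r-1}\bigoplus_{l\le j\le l'-1}V_{(r+r'-2i)s}(\chi^j\lambda\sigma)\ \oplus\bigoplus_{0\le i\le r-1}\bigoplus_{l'\le j\le s-1}V_{n+t-1-2is-2j}(\chi^j\lambda\sigma),\end{aligned}$$ and if $l\ge l'$, it is $$\begin{aligned}&\bigoplus_{i=0}^{r}\bigoplus_{j=0}^{m}V_{(r+r'+1-2i)s}(\chi^j\lambda\sigma)\ \oplus\bigoplus_{i=0}^{r}\bigoplus_{m+1\le j\le l'-1}V_{n+t-1-2is-2j}(\chi^j\lambda\sigma)\\ &\oplus\bigoplus_{i=0}^{r}\bigoplus_{l'\le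 j\le l-1}V_{(r+r'-2i)s}(\chi^j\lambda\sigma)\ \oplus\bigoplus_{0\le i\le r-1}\bigoplus_{l\le j\le s-1}V_{n+t-1-2is-2j}(\chi^j\lambda\sigma).\end{aligned}$$ -/

import Mathlib

open scoped TensorProduct DirectSum

universe u v w

noncomputable section

/-! ### The Hopf-Ore extension `H = kG(χ⁻¹, a, 0)`

Characters of `G` over `k` are the elements of the commutative group `G →* kˣ`. -/

/-- The generators of `H`: the elements of `G`, and one further element `x`. -/
inductive HopfOreGen (G : Type v) : Type v
  | grp (g : G) : HopfOreGen G
  | var : HopfOreGen G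

/-- The defining relations of `H`: the multiplication of `G`, and `x g = χ⁻¹(g) g x`. -/
inductive HopfOreRel {k : Type u} {G : Type v} [Field k] [Group G] (χ : G →* kˣ) :
    FreeAlgebra k (HopfOreGen G) → FreeAlgebra k (HopfOreGen G) → Prop
  | one : HopfOreRel χ (FreeAlgebra.ι k (HopfOreGen.grp 1)) 1
  | mul (g h : G) : HopfOreRel χ
      (FreeAlgebra.ι k (HopfOreGen.grp g) * FreeAlgebra.ι k (HopfOreGen.grp h))
      (FreeAlgebra.ι k (HopfOreGen.grp (g * h)))
  | comm (g : G) : HopfOreRel χ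
      (FreeAlgebra.ι k HopfOreGen.var * FreeAlgebra.ι k (HopfOreGen.grp g))
      (((χ⁻¹ g : kˣ) : k) •
        (FreeAlgebra.ι k (HopfOreGen.grp g) * FreeAlgebra.ι k HopfOreGen.var))

/-- The algebra underlying `H = kG(χ⁻¹, a, 0)`. It does not depend on the central element `a`,
but its comultiplication does, so that `a` is part of the type. -/
def HopfOre {k : Type u} {G : Type v} [Field k] [Group G]
    (χ : G →* kˣ) (_a : Subgroup.center G) : Type (max u v) :=
  RingQuot (HopfOreRel χ)

namespace HopfOre

variable {k : Type u} {G : Type v} [Field k] [Group G] (χ : G →* kˣ) (a : Subgroup.center G)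

instance : Ring (HopfOre χ a) := inferInstanceAs (Ring (RingQuot (HopfOreRel χ)))

instance : Algebra k (HopfOre χ a) := inferInstanceAs (Algebra k (RingQuot (HopfOreRel χ)))

/-- The image of `G` in `H`. -/
def of : G →* HopfOre χ a where
  toFun g := RingQuot.mkAlgHom k (HopfOreRel χ) (FreeAlgebra.ι k (HopfOreGen.grp g))
  map_one' := (RingQuot.mkAlgHom_rel k HopfOreRel.one).trans (map_one _)
  map_mul' g h := (RingQuot.mkAlgHom_rel k (HopfOreRel.mul g h)).symm.trans (map_mul _ _ _)

/-- The generator `x` of `H`. -/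
def X : HopfOre χ a := RingQuot.mkAlgHom k (HopfOreRel χ) (FreeAlgebra.ι k HopfOreGen.var)

theorem X_mul_of (g : G) :
    X χ a * of χ a g = ((χ⁻¹ g : kˣ) : k) • (of χ a g * X χ a) := by
  have h := RingQuot.mkAlgHom_rel k (HopfOreRel.comm (χ := χ) g)
  rw [map_mul, map_smul, map_mul] at h
  exact h

variable {χ a}

/-- The universal property of the algebra `H`. -/
def lift {A : Type w} [Ring A] [Algebra k A] (f : G →* A) (y : A)
    (h : ∀ g, y * f g = ((χ⁻¹ g : kˣ) : k) • (f g * y)) : HopfOre χ a →ₐ[k] A :=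
  RingQuot.liftAlgHom k ⟨FreeAlgebra.lift k fun c => HopfOreGen.casesOn c (fun g => f g) y, by
    intro p q hpq
    cases hpq with
    | one => simp
    | mul g g' => simp
    | comm g => simpa using h g⟩

@[simp] theorem lift_of {A : Type w} [Ring A] [Algebra k A] (f : G →* A) (y : A)
    (h : ∀ g, y * f g = ((χ⁻¹ g : kˣ) : k) • (f g * y)) (g : G) :
    lift (a := a) f y h (of χ a g) = f g := by
  refine (RingQuot.liftAlgHom_mkAlgHom_apply _ _ _ _).trans ?_
  simp

@[simp] theorem lift_X {A : Type w} [Ring A] [Algebra k A] (f : G →* A) (y : A)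
    (h : ∀ g, y * f g = ((χ⁻¹ g : kˣ) : k) • (f g * y)) :
    lift (a := a) f y h (X χ a) = y := by
  refine (RingQuot.liftAlgHom_mkAlgHom_apply _ _ _ _).trans ?_
  simp

theorem algHom_ext {A : Type w} [Ring A] [Algebra k A] {φ ψ : HopfOre χ a →ₐ[k] A}
    (hG : ∀ g, φ (of χ a g) = ψ (of χ a g)) (hX : φ (X χ a) = ψ (X χ a)) : φ = ψ := by
  apply RingQuot.ringQuot_ext'
  apply FreeAlgebra.hom_ext
  funext c
  cases c with
  | grp g => exact hG g
  | var => exact hX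

variable (χ a)

/-- The group-like elements `g ⊗ g`. -/
def grpTmul : G →* HopfOre χ a ⊗[k] HopfOre χ a where
  toFun g := of χ a g ⊗ₜ[k] of χ a g
  map_one' := by simp [Algebra.TensorProduct.one_def]
  map_mul' g h := by simp

theorem grpTmul_apply (g : G) : grpTmul χ a g = of χ a g ⊗ₜ[k] of χ a g := rfl

/-- The comultiplication: `Δ(g) = g ⊗ g` and `Δ(x) = x ⊗ a + 1 ⊗ x`. -/
def comulHom : HopfOre χ a →ₐ[k] HopfOre χ a ⊗[k] HopfOre χ a :=
  lift (grpTmul χ a) (X χ a ⊗ₜ[k] of χ a (a : G) + 1 ⊗ₜ[k] X χ a)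
    (by
      intro g
      have hc : of χ a (a : G) * of χ a g = of χ a g * of χ a (a : G) := by
        rw [← map_mul, ← map_mul, Subgroup.mem_center_iff.mp a.2 g]
      simp only [grpTmul_apply, add_mul, mul_add,
        Algebra.TensorProduct.tmul_mul_tmul, X_mul_of, hc, one_mul, mul_one, smul_add,
        TensorProduct.smul_tmul', TensorProduct.tmul_smul])

/-- The counit: `ε(g) = 1` and `ε(x) = 0`. -/
def counitHom : HopfOre χ a →ₐ[k] k := lift 1 0 (by simp)

@[simp] theorem comulHom_of (g : G) :
    comulHom χ a (of χ a g) = of χ a g ⊗ₜ[k] of χ a g := by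
  simp [comulHom, grpTmul_apply]

@[simp] theorem comulHom_X :
    comulHom χ a (X χ a) = X χ a ⊗ₜ[k] of χ a (a : G) + 1 ⊗ₜ[k] X χ a := by
  simp [comulHom]

@[simp] theorem counitHom_of (g : G) : counitHom χ a (of χ a g) = 1 := by
  simp [counitHom]

@[simp] theorem counitHom_X : counitHom χ a (X χ a) = 0 := by
  simp [counitHom]

instance : Bialgebra k (HopfOre χ a) :=
  Bialgebra.ofAlgHom (comulHom χ a) (counitHom χ a)
    (by
      apply algHom_ext
      · intro g; simp
      · simp [TensorProduct.add_tmul, TensorProduct.tmul_add, Algebra.TensorProduct.one_def,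
          add_assoc])
    (by
      apply algHom_ext
      · intro g; simp
      · simp)
    (by
      apply algHom_ext
      · intro g; simp
      · simp)

end HopfOre

/-! ### Tensor products of modules over a bialgebra -/

section ModTensor

/-- The tensor product over `k` of two modules over a `k`-bialgebra `A`, on which `A` acts through
its comultiplication: `h • (m ⊗ n) = ∑ h₁ m ⊗ h₂ n`. It is a synonym of `M ⊗[k] N`, which carries
other `A`-module structures. -/
def ModTensor (k : Type u) (_A : Type v) [Field k] (M N : Type w) [AddCommGroup M] [Module k M]
    [AddCommGroup N] [Module k N] : Type w :=
  M ⊗[k] N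

variable (k : Type u) (A : Type v) [Field k] [Ring A] [Bialgebra k A]
  (M N : Type w) [AddCommGroup M] [Module k M] [AddCommGroup N] [Module k N]

instance : AddCommGroup (ModTensor k A M N) := inferInstanceAs (AddCommGroup (M ⊗[k] N))

instance : Module k (ModTensor k A M N) := inferInstanceAs (Module k (M ⊗[k] N))

variable [Module A M] [IsScalarTower k A M] [Module A N] [IsScalarTower k A N]

/-- The action of `A` on `M ⊗ N`, the composite
`A → A ⊗ A → End M ⊗ End N → End (M ⊗ N)`. -/
def ModTensor.action : A →ₐ[k] Module.End k (M ⊗[k] N) :=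
  (Module.endTensorEndAlgHom (R := k) (S := k) (A := k) (M := M) (N := N)).comp
    ((Algebra.TensorProduct.map (Algebra.lsmul k k M) (Algebra.lsmul k k N)).comp
      (Bialgebra.comulAlgHom k A))

instance : Module A (ModTensor k A M N) :=
  Module.compHom (M ⊗[k] N) (ModTensor.action k A M N).toRingHom

instance : IsScalarTower k A (ModTensor k A M N) where
  smul_assoc c h m := by
    change ModTensor.action k A M N (c • h) m = c • ModTensor.action k A M N h m
    rw [map_smul]; rfl

/-- The pure tensor `m ⊗ n`, as an element of the `A`-module `M ⊗ N`. -/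
def ModTensor.tmul (m : M) (n : N) : ModTensor k A M N := m ⊗ₜ[k] n

end ModTensor

section

variable {k : Type u} {G : Type v} [Field k] [Group G] (χ : G →* kˣ) (a : Subgroup.center G)
  (M N : Type w) [AddCommGroup M] [Module k M] [AddCommGroup N] [Module k N]
  [Module (HopfOre χ a) M] [IsScalarTower k (HopfOre χ a) M]
  [Module (HopfOre χ a) N] [IsScalarTower k (HopfOre χ a) N]

theorem HopfOre.of_smul_tmul (g : G) (m : M) (n : N) :
    HopfOre.of χ a g • ModTensor.tmul k (HopfOre χ a) M N m n =
      ModTensor.tmul k (HopfOre χ a) M N (HopfOre.of χ a g • m) (HopfOre.of χ a g • n) := by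
  change Module.endTensorEndAlgHom (R := k) (S := k) (A := k) (M := M) (N := N)
    (Algebra.TensorProduct.map (Algebra.lsmul k k M) (Algebra.lsmul k k N)
      (HopfOre.comulHom χ a (HopfOre.of χ a g))) (m ⊗ₜ[k] n) = _
  rw [HopfOre.comulHom_of]
  rfl

theorem HopfOre.X_smul_tmul (m : M) (n : N) :
    HopfOre.X χ a • ModTensor.tmul k (HopfOre χ a) M N m n =
      ModTensor.tmul k (HopfOre χ a) M N (HopfOre.X χ a • m) (HopfOre.of χ a (a : G) • n) +
        ModTensor.tmul k (HopfOre χ a) M N m (HopfOre.X χ a • n) := by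
  change Module.endTensorEndAlgHom (R := k) (S := k) (A := k) (M := M) (N := N)
    (Algebra.TensorProduct.map (Algebra.lsmul k k M) (Algebra.lsmul k k N)
      (HopfOre.comulHom χ a (HopfOre.X χ a))) (m ⊗ₜ[k] n) = _
  rw [HopfOre.comulHom_X, map_add, map_add, LinearMap.add_apply]
  simp only [Algebra.TensorProduct.map_tmul, map_one]
  rfl

end

/-! ### The modules of nilpotent type -/

section NilMod

/-- The underlying space of `V_t(μ)`: a `k`-space with basis `m_0, …, m_{t-1}`.
In particular `V_0(μ) = 0`. -/
def NilMod {k : Type u} {G : Type v} [Field k] [Group G] (_χ : G →* kˣ) (_a : Subgroup.center G)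
    (t : ℕ) (_μ : G →* kˣ) : Type u :=
  Fin t → k

variable {k : Type u} {G : Type v} [Field k] [Group G] (χ : G →* kˣ) (a : Subgroup.center G)
  (t : ℕ) (μ : G →* kˣ)

instance : AddCommGroup (NilMod χ a t μ) := inferInstanceAs (AddCommGroup (Fin t → k))

instance : Module k (NilMod χ a t μ) := inferInstanceAs (Module k (Fin t → k))

namespace NilMod

/-- The action of `G`: `g • m_i = χ^i(g) μ(g) m_i`. -/
def grpAct : G →* Module.End k (Fin t → k) where
  toFun g := LinearMap.pi fun i => (((χ ^ (i : ℕ) * μ) g : kˣ) : k) • LinearMap.proj i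
  map_one' := by ext; simp
  map_mul' g h := by
    refine LinearMap.ext fun f => funext fun i => ?_
    simp [mul_pow, mul_assoc, mul_comm, mul_left_comm]

/-- The action of `x`: `x • m_i = m_{i+1}` for `i + 1 < t`, and `x • m_{t-1} = 0`. -/
def xAct : Module.End k (Fin t → k) :=
  LinearMap.pi fun i =>
    if 0 < (i : ℕ) then LinearMap.proj ⟨(i : ℕ) - 1, by omega⟩ else 0

theorem grpAct_apply (g : G) (f : Fin t → k) (i : Fin t) :
    grpAct χ t μ g f i = (((χ ^ (i : ℕ) * μ) g : kˣ) : k) * f i := rfl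

theorem xAct_apply (f : Fin t → k) (i : Fin t) :
    xAct t f i = if 0 < (i : ℕ) then f ⟨(i : ℕ) - 1, by omega⟩ else 0 := by
  unfold xAct
  rw [LinearMap.pi_apply]
  split_ifs <;> rfl

/-- The action of `H` on `V_t(μ)`. -/
def action : HopfOre χ a →ₐ[k] Module.End k (Fin t → k) :=
  HopfOre.lift (grpAct χ t μ) (xAct t) (by
    intro g
    refine LinearMap.ext fun f => funext fun i => ?_
    simp only [Module.End.mul_apply, LinearMap.smul_apply, Pi.smul_apply, xAct_apply,
      grpAct_apply, smul_eq_mul]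
    split_ifs with h
    · obtain ⟨j, hj⟩ : ∃ j, (i : ℕ) = j + 1 := ⟨(i : ℕ) - 1, by omega⟩
      simp only [hj, Nat.add_sub_cancel, pow_succ, MonoidHom.mul_apply, MonoidHom.inv_apply,
        MonoidHom.pow_apply, Units.val_mul, Units.val_inv_eq_inv_val]
      field_simp
    · simp)

instance : Module (HopfOre χ a) (NilMod χ a t μ) :=
  Module.compHom (Fin t → k) (action χ a t μ).toRingHom

instance : IsScalarTower k (HopfOre χ a) (NilMod χ a t μ) where
  smul_assoc c h m := by
    change action χ a t μ (c • h) m = c • action χ a t μ h m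
    rw [map_smul]; rfl

/-- The basis vector `m_i` of `V_t(μ)`. -/
def basisVec (i : Fin t) : NilMod χ a t μ := (Pi.single i 1 : Fin t → k)

theorem of_smul_basisVec (g : G) (i : Fin t) :
    HopfOre.of χ a g • basisVec χ a t μ i =
      (((χ g) ^ (i : ℕ) * μ g : kˣ) : k) • basisVec χ a t μ i := by
  change action χ a t μ (HopfOre.of χ a g) (Pi.single i 1) = _ • (Pi.single i 1 : Fin t → k)
  rw [action, HopfOre.lift_of]
  funext j
  rw [grpAct_apply]
  change _ = _ * (Pi.single i 1 : Fin t → k) j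
  by_cases h : j = i
  · subst h; simp
  · simp [h]

theorem X_smul_basisVec (i : Fin t) :
    HopfOre.X χ a • basisVec χ a t μ i =
      if h : (i : ℕ) + 1 < t then basisVec χ a t μ ⟨(i : ℕ) + 1, h⟩ else 0 := by
  change action χ a t μ (HopfOre.X χ a) (Pi.single i 1) = _
  rw [action, HopfOre.lift_X]
  funext j
  rw [xAct_apply]
  split_ifs with h1 h2 h2
  · simp only [basisVec, Pi.single_apply, Fin.ext_iff]
    congr 1
    apply propext
    omega
  · have : (⟨(j : ℕ) - 1, by omega⟩ : Fin t) ≠ i := by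
      intro h
      have := congrArg Fin.val h
      simp only at this
      omega
    simp only [Pi.single_apply, this, if_false]
    rfl
  · have : j ≠ ⟨(i : ℕ) + 1, h2⟩ := by
      intro h
      have := congrArg Fin.val h
      simp only at this
      omega
    simp [basisVec, this]
  · rfl

end NilMod

/-- The direct sum `⨁_{i ∈ I} ⨁_{j ∈ J} V_{d(i,j)}(χ^j μ)`; it is zero if `I` or `J` is empty. -/
abbrev NilSum (μ : G →* kˣ) (I J : Finset ℕ) (d : ℕ → ℕ → ℕ) : Type u :=
  ⨁ i : I, ⨁ j : J, NilMod χ a (d i j) (χ ^ (j : ℕ) * μ)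

end NilMod

end

/-!
Both tensor products are quotients of the quantum plane `k⟨u, w⟩`, `w u = ω u w`: after rescaling
the basis, `m_i ⊗ m_j` becomes `uⁱ w^j` modulo `(u^n, w^t)`, with `x` acting as left multiplication
by `u + w` and degree `d` having weight `χ^d λ σ`. Here `ω` is `χ⁻¹(a)` for one order of the factors
and `χ(a)` for the other, in both cases a primitive `s`-th root of unity. A graded module over
`k[x]` on which `x` is nilpotent is a sum of strings, and the strings are the modules `V_m(μ)`. Modulo
`x` the module is spanned by the powers `w^d`, `d < t`, so exactly one string starts in each degree
`d < t`. Its length is `stringLength`. It suffices to find, for each `d = i s + j < t`, an element of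
degree `d` outside the image of `x` that is killed by the right power of `x`
(`QuantumPlane.hasString_stringLength`): these generate, and the lengths add up to `n t`, so that
the resulting surjection from the direct sum is bijective (`IsStringSystem.nonempty_equiv`). As the
answer does not depend on `ω`, the two tensor products are isomorphic.

To find the elements one uses that `x^s = U + W` with `U = u^s` and `W = w^s` central. The Lefschetz
property of `k⟨u, w⟩/(u^N, w^T)` for `x` holds as long as the quantum integers involved do not vanish
(`QuantumPlane.eq_zero_of_qx_pow_mem_box`). It applies to the commutative ring `k[U, W]`, by
characteristic zero, and to the exponents `l', l < s`. The quantum plane is then cut into pieces over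
`k[x, W]` compatible with both ideals: pieces of rank one, which are copies of
`k[U, W]/(U^N, W^T)` and account for the lengths divisible by `s`
(`QuantumPlane.hasString_of_free`), and pieces of rank two spanned by a primitive element `g` of
`k⟨u, w⟩/(u^l', w^l)` and the `u^l'`-component of `x^c g`, which account for the lengths
`n + t - 1 - 2d` (`QuantumPlane.hasString_of_linkedPair_lower`,
`QuantumPlane.hasString_of_linkedPair_upper`).
-/

noncomputable section


namespace QuantumPlane

open Polynomial

variable {k : Type u} [Field k]

/-! ### Multiplication by `x` on the quantum plane -/

/-- Left multiplication by `x = u + w` on the quantum plane `k⟨u, w⟩`, `w u = ω u w`.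
The element `∑ cᵢ uⁱ w^(d-i)` of degree `d` is encoded by the polynomial `∑ cᵢ Xⁱ` of degree at
most `d`; as `x uⁱ w^j = u^(i+1) w^j + ωⁱ uⁱ w^(j+1)`, the formula for `x` is the same for all `d`. -/
def qx (ω : k) : k[X] →ₗ[k] k[X] :=
  LinearMap.mulLeft k X + (aeval (C ω * X : k[X])).toLinearMap

theorem qx_apply (ω : k) (f : k[X]) : qx ω f = X * f + f.comp (C ω * X) := rfl

theorem coeff_qx_zero (ω : k) (f : k[X]) : (qx ω f).coeff 0 = f.coeff 0 := by
  rw [qx_apply, coeff_add, comp_C_mul_X_coeff]; simp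

theorem coeff_qx_succ (ω : k) (f : k[X]) (i : ℕ) :
    (qx ω f).coeff (i + 1) = f.coeff i + ω ^ (i + 1) * f.coeff (i + 1) := by
  rw [qx_apply, coeff_add, comp_C_mul_X_coeff, coeff_X_mul, mul_comm]

theorem mem_degreeLT_iff_coeff {m : ℕ} {f : k[X]} :
    f ∈ degreeLT k m ↔ ∀ i, m ≤ i → f.coeff i = 0 := by
  rw [mem_degreeLT, degree_lt_iff_coeff_zero]

theorem qx_mem_degreeLT (ω : k) {m : ℕ} {f : k[X]} (hf : f ∈ degreeLT k m) :
    qx ω f ∈ degreeLT k (m + 1) := by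
  rw [mem_degreeLT_iff_coeff] at *
  rintro (_ | i) hi
  · omega
  · rw [coeff_qx_succ, hf i (by omega), hf (i + 1) (by omega)]; simp

theorem qx_pow_mem_degreeLT (ω : k) {m : ℕ} {f : k[X]} (hf : f ∈ degreeLT k m) (c : ℕ) :
    (qx ω ^ c) f ∈ degreeLT k (m + c) := by
  induction c with
  | zero => simpa using hf
  | succ c ih => rw [pow_succ', Module.End.mul_apply]; exact qx_mem_degreeLT ω ih

theorem degreeLT_zero_eq {f : k[X]} (hf : f ∈ degreeLT k 0) : f = 0 := by
  ext i; simpa using mem_degreeLT_iff_coeff.1 hf i (Nat.zero_le i)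

/-- The degree `D` part of the ideal `(u^N, w^T)`: the coefficient of `uⁱ w^(D-i)` vanishes whenever
`i < N` and `D - i < T`. -/
def box (N T D : ℕ) : Submodule k k[X] where
  carrier := {f | ∀ i, i < N → D < i + T → f.coeff i = 0}
  add_mem' hf hg i h1 h2 := by rw [coeff_add, hf i h1 h2, hg i h1 h2, add_zero]
  zero_mem' i _ _ := coeff_zero i
  smul_mem' c f hf i h1 h2 := by rw [coeff_smul, hf i h1 h2, smul_zero]

theorem dvd_mem_box {N T D : ℕ} {f : k[X]} (hf : X ^ N ∣ f) : f ∈ box N T D := fun i h _ =>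
  X_pow_dvd_iff.1 hf i h

theorem degreeLT_mem_box {N T D : ℕ} {f : k[X]} (hf : f ∈ degreeLT k (D + 1 - T)) :
    f ∈ box N T D := fun i _ h => mem_degreeLT_iff_coeff.1 hf i (by omega)

/-- An element of `(u^N, w^T)` of degree `D` is a sum of a multiple of `u^N` and one of `w^T`; in the
encoding by polynomials in `u`, divisibility by `w^T` is a bound on the degree. -/
theorem exists_add_of_mem_box {N T D : ℕ} {f : k[X]} (hf : f ∈ box N T D) :
    ∃ f₁ f₂, f = f₁ + f₂ ∧ X ^ N ∣ f₁ ∧ f₂ ∈ degreeLT k (D + 1 - T) := by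
  have hm : (X ^ N : k[X]).Monic := monic_X_pow N
  refine ⟨X ^ N * (f /ₘ X ^ N), f %ₘ X ^ N, ?_, dvd_mul_right _ _, ?_⟩
  · rw [add_comm, modByMonic_add_div]
  · rw [mem_degreeLT_iff_coeff]
    intro i hi
    by_cases h : i < N
    · have h1 := congrArg (fun p => coeff p i) (modByMonic_add_div f (X ^ N : k[X]))
      simp only [coeff_add, coeff_X_pow_mul', not_le.2 h, if_false, add_zero] at h1
      rw [h1, hf i h (by omega)]
    · refine coeff_eq_zero_of_degree_lt ((degree_modByMonic_lt f hm).trans_le ?_)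
      rw [degree_X_pow]; exact_mod_cast not_lt.1 h

/-! ### The twisted derivation -/

/-- The quantum integer `[m] = 1 + ω + ⋯ + ω^(m-1)`. -/
def qnum (ω : k) (m : ℕ) : k := ∑ i ∈ Finset.range m, ω ^ i

theorem qnum_zero (ω : k) : qnum ω 0 = 0 := by simp [qnum]

theorem qnum_succ (ω : k) (m : ℕ) : qnum ω (m + 1) = qnum ω m + ω ^ m :=
  Finset.sum_range_succ _ _

theorem qnum_succ' (ω : k) (m : ℕ) : qnum ω (m + 1) = 1 + ω * qnum ω m := by
  rw [qnum, Finset.sum_range_succ', qnum, Finset.mul_sum, add_comm]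
  simp [pow_succ']

/-- The twisted derivation that lowers degree `d` to degree `d - 1` and kills the powers of `x`. Up to
the factor `ω^(d-1)`, which avoids inverses, it sends `uⁱ w^j` to
`[i] ω^(-j) u^(i-1) w^j - [j]_(ω⁻¹) uⁱ w^(j-1)`. -/
def qd (ω : k) (d : ℕ) (f : k[X]) : k[X] :=
  ∑ i ∈ Finset.range d,
    monomial i (ω ^ i * (qnum ω (i + 1) * f.coeff (i + 1) - qnum ω (d - i) * f.coeff i))

theorem qd_mem_degreeLT (ω : k) (d : ℕ) (f : k[X]) : qd ω d f ∈ degreeLT k d := by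
  refine Submodule.sum_mem _ fun i hi => ?_
  rw [mem_degreeLT]
  exact (degree_monomial_le _ _).trans_lt (by exact_mod_cast Finset.mem_range.1 hi)

theorem coeff_qd {ω : k} {d : ℕ} {f : k[X]} (hf : f ∈ degreeLT k (d + 1)) (i : ℕ) :
    (qd ω d f).coeff i =
      ω ^ i * (qnum ω (i + 1) * f.coeff (i + 1) - qnum ω (d - i) * f.coeff i) := by
  rw [qd, finsetSum_coeff]
  simp only [coeff_monomial, Finset.sum_ite_eq', Finset.mem_range]
  split_ifs with h
  · rfl
  · rw [mem_degreeLT_iff_coeff.1 hf (i + 1) (by omega), Nat.sub_eq_zero_of_le (not_lt.1 h),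
      qnum_zero]
    simp

/-- The twisted derivation commutes with multiplication by `x`, up to a scalar. -/
theorem qd_qx {ω : k} {d : ℕ} {f : k[X]} (hf : f ∈ degreeLT k (d + 1)) :
    qd ω (d + 1) (qx ω f) = ω • qx ω (qd ω d f) := by
  ext i
  rw [coeff_qd (qx_mem_degreeLT ω hf), coeff_smul, smul_eq_mul]
  rcases i with _ | i
  · rw [coeff_qx_zero, coeff_qx_zero, coeff_qx_succ, coeff_qd hf]
    simp only [Nat.sub_zero, qnum_succ' ω d, zero_add, qnum_succ ω 0, qnum_zero, pow_zero]
    ring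
  · rw [coeff_qx_succ, coeff_qx_succ, coeff_qx_succ, coeff_qd hf, coeff_qd hf]
    rcases Nat.lt_or_ge i d with h | h
    · obtain ⟨m, rfl⟩ := Nat.exists_eq_add_of_lt h
      rw [show i + m + 1 + 1 - (i + 1) = m + 1 by omega, show i + m + 1 - i = m + 1 by omega,
        show i + m + 1 - (i + 1) = m by omega, qnum_succ' ω m, qnum_succ ω (i + 1)]
      ring
    · rw [mem_degreeLT_iff_coeff.1 hf (i + 1) (by omega),
        mem_degreeLT_iff_coeff.1 hf (i + 1 + 1) (by omega),
        show d + 1 - (i + 1) = d - i by omega]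
      ring

theorem qd_qx_pow {ω : k} {d : ℕ} {f : k[X]} (hf : f ∈ degreeLT k (d + 1)) (c : ℕ) :
    qd ω (d + c) ((qx ω ^ c) f) = ω ^ c • (qx ω ^ c) (qd ω d f) := by
  induction c with
  | zero => simp
  | succ c ih =>
    have h := qx_pow_mem_degreeLT ω hf c
    rw [pow_succ' (qx ω), Module.End.mul_apply, Module.End.mul_apply, ← add_assoc,
      qd_qx (by convert h using 2; omega), ih, map_smul, smul_smul, pow_succ']

theorem one_mem_degreeLT {m : ℕ} (hm : 0 < m) : (1 : k[X]) ∈ degreeLT k m := by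
  rw [mem_degreeLT]
  exact degree_one_le.trans_lt (by exact_mod_cast hm)

/-- The recursion for the coefficients of `x^p`, read off from the vanishing of its twisted
derivative; it replaces the product formula for `q`-binomial coefficients. -/
theorem coeff_qx_pow_one_rec {ω : k} (hω : ω ≠ 0) (p i : ℕ) :
    qnum ω (i + 1) * ((qx ω ^ p) 1).coeff (i + 1) =
      qnum ω (p - i) * ((qx ω ^ p) 1).coeff i := by
  have h1 : (1 : k[X]) ∈ degreeLT k (0 + 1) := one_mem_degreeLT (by omega)
  have h := qd_qx_pow (ω := ω) h1 p
  rw [degreeLT_zero_eq (qd_mem_degreeLT ω 0 1), map_zero, smul_zero, zero_add] at h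
  have h2 := qx_pow_mem_degreeLT ω h1 p
  have h3 := coeff_qd (ω := ω) (d := p) (by convert h2 using 2; omega) i
  rw [h, coeff_zero] at h3
  exact sub_eq_zero.1 ((mul_eq_zero.1 h3.symm).resolve_left (pow_ne_zero i hω))

theorem coeff_zero_qx_pow_one (ω : k) (p : ℕ) : ((qx ω ^ p) 1).coeff 0 = 1 := by
  induction p with
  | zero => simp
  | succ p ih => rw [pow_succ', Module.End.mul_apply, coeff_qx_zero, ih]

theorem coeff_self_qx_pow_one (ω : k) (p : ℕ) : ((qx ω ^ p) 1).coeff p = 1 := by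
  induction p with
  | zero => simp
  | succ p ih =>
    have h2 := qx_pow_mem_degreeLT ω (one_mem_degreeLT (k := k) one_pos) p
    rw [pow_succ', Module.End.mul_apply, coeff_qx_succ, ih,
      mem_degreeLT_iff_coeff.1 h2 (p + 1) (by omega)]
    simp

theorem coeff_qx_pow_one_ne_zero {ω : k} (hω : ω ≠ 0) {p : ℕ}
    (hq : ∀ m, 0 < m → m ≤ p → qnum ω m ≠ 0) {i : ℕ} (hi : i ≤ p) :
    ((qx ω ^ p) 1).coeff i ≠ 0 := by
  induction i with
  | zero => rw [coeff_zero_qx_pow_one]; exact one_ne_zero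
  | succ i ih =>
    intro h
    have := coeff_qx_pow_one_rec hω p i
    rw [h, mul_zero] at this
    exact mul_ne_zero (hq _ (by omega) (by omega)) (ih (by omega)) this.symm

theorem eq_smul_of_qd_eq_zero {ω : k} (hω : ω ≠ 0) {e : ℕ}
    (hq : ∀ m, 0 < m → m ≤ e → qnum ω m ≠ 0) {f : k[X]} (hf : f ∈ degreeLT k (e + 1))
    (hd : qd ω e f = 0) : f = f.coeff 0 • (qx ω ^ e) 1 := by
  have h2 := qx_pow_mem_degreeLT ω (one_mem_degreeLT (k := k) one_pos) e
  ext i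
  rw [coeff_smul, smul_eq_mul]
  induction i with
  | zero => rw [coeff_zero_qx_pow_one, mul_one]
  | succ i ih =>
    rcases Nat.lt_or_ge i e with h | h
    · have h3 := coeff_qd (ω := ω) hf i
      rw [hd, coeff_zero] at h3
      have h3 := sub_eq_zero.1 ((mul_eq_zero.1 h3.symm).resolve_left (pow_ne_zero i hω))
      have h4 := coeff_qx_pow_one_rec hω e i
      refine mul_left_cancel₀ (hq (i + 1) (by omega) (by omega)) ?_
      rw [h3, mul_left_comm, h4, ih]
      ring
    · rw [mem_degreeLT_iff_coeff.1 hf _ (by omega), mem_degreeLT_iff_coeff.1 h2 _ (by omega),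
        mul_zero]

/-! ### The Lefschetz property -/

theorem qd_mem_box {ω : k} {N T D : ℕ} {f : k[X]} (hf : f ∈ degreeLT k (D + 1 + 1))
    (hbox : f ∈ box (N + 1) (T + 1) (D + 1)) : qd ω (D + 1) f ∈ box N T D := by
  intro i h1 h2
  rw [coeff_qd hf, hbox i (by omega) (by omega), hbox (i + 1) (by omega) (by omega)]
  simp

/-- Multiplication by `x^c` is injective from degree `e` of `k⟨u, w⟩` to the complementary degree of
`k⟨u, w⟩/(u^N, w^T)`, as long as the quantum integers involved do not vanish. By induction on `e`,
the twisted derivative of an element of the kernel vanishes, since it lies in the kernel for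
`(u^(N-1), w^(T-1))`; so the element is a multiple of `x^e`, and `x^(e+c)` is not in `(u^N, w^T)`. -/
theorem eq_zero_of_qx_pow_mem_box {ω : k} (hω : ω ≠ 0) {e N T c : ℕ} (hNT : N + T = 2 * e + 2 + c)
    (hN : e < N) (hT : e < T) (hq : ∀ m, 0 < m → m ≤ e + c → qnum ω m ≠ 0)
    {f : k[X]} (hf : f ∈ degreeLT k (e + 1)) (hbox : (qx ω ^ c) f ∈ box N T (e + c)) : f = 0 := by
  induction e generalizing N T f with
  | zero =>
    have h := eq_smul_of_qd_eq_zero hω (fun m h1 h2 => absurd h1 (by omega)) hf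
      (degreeLT_zero_eq (qd_mem_degreeLT ω 0 f))
    rw [h, pow_zero, Module.End.one_apply, map_smul] at hbox
    -- the coefficient of `u^(N-1) w^(T-1)` in `x^c` is not zero
    have h0 := hbox (N - 1) (by omega) (by omega)
    rw [coeff_smul, smul_eq_mul] at h0
    rw [h, (mul_eq_zero.1 h0).resolve_right
      (coeff_qx_pow_one_ne_zero hω (fun m h1 h2 => hq m h1 (by omega)) (by omega)), zero_smul]
  | succ e ih =>
    obtain ⟨N, rfl⟩ : ∃ N', N = N' + 1 := ⟨N - 1, by omega⟩
    obtain ⟨T, rfl⟩ : ∃ T', T = T' + 1 := ⟨T - 1, by omega⟩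
    have hd : qd ω (e + 1) f = 0 := by
      refine ih (N := N) (T := T) (by omega) (by omega) (by omega)
        (fun m h1 h2 => hq m h1 (by omega)) (qd_mem_degreeLT ω (e + 1) f) ?_
      have h1 := qx_pow_mem_degreeLT ω hf c
      have h2 := qd_mem_box (ω := ω) (N := N) (T := T) (D := e + c) (f := (qx ω ^ c) f)
        (by convert h1 using 2; omega) (by convert hbox using 2; omega)
      rw [show e + c + 1 = e + 1 + c by omega, qd_qx_pow hf] at h2
      simpa [smul_smul, hω] using (box N T (e + c)).smul_mem (ω ^ c)⁻¹ h2
    have h := eq_smul_of_qd_eq_zero hω (fun m h1 h2 => hq m h1 (by omega)) hf hd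
    rw [h, map_smul, ← Module.End.mul_apply, ← pow_add] at hbox
    -- the coefficient of `u^N` in `x^(e+1+c)` is not zero
    have h0 := hbox (N + 1 - 1) (by omega) (by omega)
    rw [coeff_smul, smul_eq_mul] at h0
    rw [h, (mul_eq_zero.1 h0).resolve_right
      (coeff_qx_pow_one_ne_zero hω (fun m h1 h2 => hq m h1 (by omega)) (by omega)), zero_smul]

/-! ### The cokernel of multiplication by `x` -/

/-- The functional `uⁱ w^j ↦ ∏_{m < i} (-ω^m)`. In every degree its kernel is the image of `x`, so it
detects the elements that generate `k⟨u, w⟩/(x)`. -/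
def phi (ω : k) : k[X] →ₗ[k] k :=
  Polynomial.lsum fun i => LinearMap.mulRight k (∏ j ∈ Finset.range i, -ω ^ j)

theorem phi_X_pow (ω : k) (i : ℕ) : phi ω (X ^ i) = ∏ j ∈ Finset.range i, -ω ^ j := by
  rw [← monomial_one_right_eq_X_pow, phi, lsum_apply]
  simp

theorem phi_one (ω : k) : phi ω 1 = 1 := by simpa using phi_X_pow ω 0

theorem phi_X_pow_ne_zero {ω : k} (hω : ω ≠ 0) (i : ℕ) : phi ω (X ^ i) ≠ 0 := by
  rw [phi_X_pow]
  exact Finset.prod_ne_zero_iff.2 fun j _ => neg_ne_zero.2 (pow_ne_zero j hω)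

theorem qx_X_pow (ω : k) (i : ℕ) : qx ω (X ^ i) = X ^ (i + 1) + ω ^ i • X ^ i := by
  rw [qx_apply, X_pow_comp, mul_pow, ← C_pow, smul_eq_C_mul, pow_succ']

theorem phi_qx (ω : k) (f : k[X]) : phi ω (qx ω f) = 0 := by
  have : (phi ω).comp (qx ω) = 0 := by
    refine lhom_ext' fun i => LinearMap.ext_ring ?_
    simp only [LinearMap.comp_apply, monomial_one_right_eq_X_pow, qx_X_pow, map_add, map_smul,
      phi_X_pow, Finset.prod_range_succ, LinearMap.zero_apply, smul_eq_mul]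
    ring
  exact LinearMap.congr_fun this f

theorem exists_sub_phi_eq_qx (ω : k) {d : ℕ} {f : k[X]} (hf : f ∈ degreeLT k (d + 1)) :
    ∃ g ∈ degreeLT k d, f - C (phi ω f) = qx ω g := by
  have key : ∀ i ≤ d, ∃ g ∈ degreeLT k d, X ^ i - C (phi ω (X ^ i)) = qx ω g := by
    intro i
    induction i with
    | zero => exact fun _ => ⟨0, zero_mem _, by simp [phi_one]⟩
    | succ i ih =>
      intro hi
      obtain ⟨g, hg, h⟩ := ih (by omega)
      refine ⟨X ^ i - ω ^ i • g, sub_mem ?_ (Submodule.smul_mem _ _ hg), ?_⟩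
      · rw [mem_degreeLT, degree_X_pow]; exact_mod_cast hi
      · rw [map_sub, map_smul, ← h, qx_X_pow, phi_X_pow, phi_X_pow, Finset.prod_range_succ,
          smul_sub, smul_eq_C_mul, smul_eq_C_mul, ← C_mul]
        simp
        ring
  choose! G hG h using key
  refine ⟨∑ i ∈ Finset.range (d + 1), f.coeff i • G i, Submodule.sum_mem _ fun i hi =>
    Submodule.smul_mem _ _ (hG i (by simpa [Nat.lt_succ_iff] using hi)), ?_⟩
  have hsum : f = ∑ i ∈ Finset.range (d + 1), f.coeff i • X ^ i := by
    conv_lhs => rw [f.as_sum_range' (d + 1) (by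
      by_cases h0 : f = 0
      · simp [h0]
      · exact (natDegree_lt_iff_degree_lt h0).2 (mem_degreeLT.1 hf))]
    simp only [smul_X_eq_monomial]
  rw [map_sum]
  conv_lhs => rw [hsum]
  rw [map_sum, map_sum, ← Finset.sum_sub_distrib]
  refine Finset.sum_congr rfl fun i hi => ?_
  rw [map_smul (phi ω), map_smul (qx ω), ← h i (by simpa [Nat.lt_succ_iff] using hi), smul_eq_mul,
    C_mul, smul_sub, smul_eq_C_mul, smul_eq_C_mul]

theorem exists_eq_qx_of_phi_eq_zero {ω : k} {d : ℕ} {f : k[X]} (hf : f ∈ degreeLT k (d + 1))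
    (h : phi ω f = 0) : ∃ g ∈ degreeLT k d, f = qx ω g := by
  obtain ⟨g, hg, h'⟩ := exists_sub_phi_eq_qx ω hf
  exact ⟨g, hg, by simpa [h] using h'⟩

/-! ### Primitive elements -/

/-- The coefficients of `x^c f` with index in `[N - m, N)`, for `f` of degree `e`. When
`m = e + c + 1 - T`, their vanishing says that `x^c f` lies in `(u^N, w^T)`. -/
def boxCoeff (ω : k) (e N c : ℕ) (m : ℕ) : degreeLT k (e + 1) →ₗ[k] (Fin m → k) :=
  LinearMap.pi fun i => (lcoeff k (N - m + i)).comp ((qx ω ^ c).comp (degreeLT k (e + 1)).subtype)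

theorem finrank_degreeLT (m : ℕ) : Module.finrank k (degreeLT k m) = m := by
  rw [(degreeLTEquiv k m).finrank_eq, Module.finrank_fin_fun]

/-- The generator of a Lefschetz string of length `c` that starts in degree `e`. It exists by counting
dimensions, and it is not in the image of `x` by injectivity one degree lower. -/
theorem exists_primitive {ω : k} (hω : ω ≠ 0) {e N T c : ℕ} (hNT : N + T = 2 * e + 1 + c)
    (hN : e ≤ N) (hT : e ≤ T) (hq : ∀ m, 0 < m → m ≤ e + c → qnum ω m ≠ 0) :
    ∃ f ∈ degreeLT k (e + 1), phi ω f = 1 ∧ (qx ω ^ c) f ∈ box N T (e + c) := by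
  have : Module.Finite k (degreeLT k (e + 1)) := Module.Finite.equiv (degreeLTEquiv k (e + 1)).symm
  obtain ⟨⟨f, hf⟩, hker, hne⟩ := Submodule.exists_mem_ne_zero_of_ne_bot
    (LinearMap.ker_ne_bot_of_finrank_lt (f := boxCoeff ω e N c e)
      (by rw [finrank_degreeLT, Module.finrank_fin_fun]; omega))
  have hbox : (qx ω ^ c) f ∈ box N T (e + c) := by
    intro i h1 h2
    have := congrFun (LinearMap.mem_ker.1 hker) ⟨i - (N - e), by omega⟩
    simpa [boxCoeff, show N - e + (i - (N - e)) = i by omega] using this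
  have hphi : phi ω f ≠ 0 := by
    intro h0
    apply hne
    obtain ⟨g, hg, rfl⟩ := exists_eq_qx_of_phi_eq_zero hf h0
    suffices hg0 : g = 0 by
      subst hg0; ext1; simp
    rcases e with _ | e
    · exact degreeLT_zero_eq hg
    · refine eq_zero_of_qx_pow_mem_box (N := N) (T := T) (c := c + 1) hω (by omega) (by omega)
        (by omega) (fun m h1 h2 => hq m h1 (by omega)) hg ?_
      rw [pow_succ, Module.End.mul_apply]
      convert hbox using 2; omega
  refine ⟨(phi ω f)⁻¹ • f, Submodule.smul_mem _ _ hf, by simp [hphi], ?_⟩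
  rw [map_smul]
  exact Submodule.smul_mem _ _ hbox

/-- The injection of `eq_zero_of_qx_pow_mem_box` is onto, both sides having dimension `e + 1`. -/
theorem exists_qx_pow_sub_mem_box {ω : k} (hω : ω ≠ 0) {e N T c : ℕ} (hNT : N + T = 2 * e + 2 + c)
    (hN : e < N) (hT : e < T) (hq : ∀ m, 0 < m → m ≤ e + c → qnum ω m ≠ 0) (g : k[X]) :
    ∃ f ∈ degreeLT k (e + 1), (qx ω ^ c) f - g ∈ box N T (e + c) := by
  have : Module.Finite k (degreeLT k (e + 1)) := Module.Finite.equiv (degreeLTEquiv k (e + 1)).symm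
  have hinj : Function.Injective (boxCoeff ω e N c (e + 1)) := by
    rw [injective_iff_map_eq_zero]
    rintro ⟨f, hf⟩ h0
    ext1
    refine eq_zero_of_qx_pow_mem_box hω hNT hN hT hq hf ?_
    intro i h1 h2
    have := congrFun h0 ⟨i - (N - (e + 1)), by omega⟩
    simpa [boxCoeff, show N - (e + 1) + (i - (N - (e + 1))) = i by omega] using this
  have hsurj := (LinearMap.injective_iff_surjective_of_finrank_eq_finrank
    (by rw [finrank_degreeLT, Module.finrank_fin_fun])).1 hinj
  obtain ⟨⟨f, hf⟩, h⟩ := hsurj fun i => g.coeff (N - (e + 1) + i)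
  refine ⟨f, hf, fun i h1 h2 => ?_⟩
  have := congrFun h ⟨i - (N - (e + 1)), by omega⟩
  simpa [boxCoeff, show N - (e + 1) + (i - (N - (e + 1))) = i by omega, sub_eq_zero] using this

theorem qx_pow_one_apply (c : ℕ) (f : k[X]) : (qx (1 : k) ^ c) f = (X + 1) ^ c * f := by
  induction c with
  | zero => simp
  | succ c ih =>
    rw [pow_succ', Module.End.mul_apply, ih, qx_apply]
    simp
    ring

theorem phi_one_left (f : k[X]) : phi (1 : k) f = f.eval (-1) := by
  have : phi (1 : k) = leval (-1) := by
    refine lhom_ext' fun i => LinearMap.ext_ring ?_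
    simp [monomial_one_right_eq_X_pow, phi_X_pow]
  rw [this]; rfl

theorem qnum_one_ne_zero [CharZero k] {m : ℕ} (hm : 0 < m) : qnum (1 : k) m ≠ 0 := by
  simp [qnum]; omega

theorem qnum_ne_zero {ω : k} {s m : ℕ} (hω : IsPrimitiveRoot ω s) (hm : 0 < m) (hms : m < s) :
    qnum ω m ≠ 0 := by
  intro h
  have := geom_sum_mul ω m
  rw [← qnum, h, zero_mul] at this
  exact hω.pow_ne_one_of_pos_of_lt hm.ne' hms (sub_eq_zero.1 this.symm)

theorem qnum_eq_zero {ω : k} {s : ℕ} (hω : IsPrimitiveRoot ω s) (hs : 1 < s) : qnum ω s = 0 :=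
  hω.geom_sum_eq_zero hs

/-! ### The central power of `x` -/

theorem qx_pow_order_one {ω : k} {s : ℕ} (hω : IsPrimitiveRoot ω s) (hs : 0 < s) :
    (qx ω ^ s) 1 = X ^ s + 1 := by
  have hω0 : ω ≠ 0 := hω.ne_zero hs.ne'
  have h : ∀ i, i + 1 < s → ((qx ω ^ s) 1).coeff (i + 1) = 0 := by
    intro i
    induction i with
    | zero =>
      intro hi
      have := coeff_qx_pow_one_rec hω0 s 0
      rw [Nat.sub_zero, qnum_eq_zero hω (by omega), zero_mul] at this
      exact (mul_eq_zero.1 this).resolve_left (qnum_ne_zero hω (by omega) (by omega))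
    | succ i ih =>
      intro hi
      have := coeff_qx_pow_one_rec hω0 s (i + 1)
      rw [ih (by omega), mul_zero] at this
      exact (mul_eq_zero.1 this).resolve_left (qnum_ne_zero hω (by omega) (by omega))
  have h2 := qx_pow_mem_degreeLT ω (one_mem_degreeLT (k := k) one_pos) s
  ext i
  rw [coeff_add, coeff_X_pow, coeff_one]
  rcases i with _ | i
  · rw [coeff_zero_qx_pow_one, if_neg (by omega)]; simp
  · rcases lt_trichotomy (i + 1) s with hi | hi | hi
    · rw [h i hi, if_neg (by omega)]; simp
    · rw [if_pos hi, hi, coeff_self_qx_pow_one]; simp; omega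
    · rw [mem_degreeLT_iff_coeff.1 h2 _ (by omega), if_neg (by omega)]; simp

/-- Multiplication by `x^p` on `u^m` is a twist of multiplication by `x^p` on `1`: move the powers of
`w` past `u^m`. -/
theorem coeff_qx_pow_X_pow (ω : k) (p m : ℕ) :
    (∀ i, ((qx ω ^ p) (X ^ m)).coeff (m + i) * ω ^ (m * i) =
      ω ^ (m * p) * ((qx ω ^ p) 1).coeff i) ∧ ∀ j < m, ((qx ω ^ p) (X ^ m)).coeff j = 0 := by
  induction p with
  | zero =>
    refine ⟨fun i => ?_, fun j hj => by simp [coeff_X_pow, hj.ne]⟩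
    rcases i with _ | i
    · simp
    · simp [coeff_X_pow, coeff_one]
  | succ p ih =>
    have hlow : ∀ j < m, ((qx ω ^ (p + 1)) (X ^ m)).coeff j = 0 := by
      intro j hj
      rw [pow_succ', Module.End.mul_apply]
      rcases j with _ | j
      · rw [coeff_qx_zero, ih.2 _ hj]
      · rw [coeff_qx_succ, ih.2 _ hj, ih.2 j (by omega)]; simp
    refine ⟨fun i => ?_, hlow⟩
    rw [pow_succ', Module.End.mul_apply, Module.End.mul_apply]
    rcases i with _ | i
    · have h0 := ih.1 0
      rw [coeff_qx_zero, coeff_zero_qx_pow_one]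
      rw [coeff_zero_qx_pow_one, add_zero, mul_zero, pow_zero, mul_one, mul_one] at h0
      rcases m with _ | m
      · rw [add_zero, coeff_qx_zero, h0]; simp
      · rw [add_zero, coeff_qx_succ, h0, ih.2 m (by omega)]; ring
    · have h0 := ih.1 i
      have h1 := ih.1 (i + 1)
      rw [← add_assoc, coeff_qx_succ, coeff_qx_succ]
      rw [← add_assoc] at h1
      linear_combination ω ^ m * h0 + ω ^ (m + i + 1) * h1

/-- The relation `x^s = u^s + w^s`, for `ω` of order `s`. -/
theorem qx_pow_order {ω : k} {s : ℕ} (hω : IsPrimitiveRoot ω s) (hs : 0 < s) (f : k[X]) :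
    (qx ω ^ s) f = (X ^ s + 1) * f := by
  have hω0 : ω ≠ 0 := hω.ne_zero hs.ne'
  suffices h : qx ω ^ s = LinearMap.mulLeft k (X ^ s + 1) from LinearMap.congr_fun h f
  refine lhom_ext' fun m => LinearMap.ext_ring ?_
  rw [LinearMap.comp_apply, LinearMap.comp_apply, monomial_one_right_eq_X_pow,
    LinearMap.mulLeft_apply, mul_comm]
  obtain ⟨h1, h2⟩ := coeff_qx_pow_X_pow ω s m
  ext j
  rw [coeff_X_pow_mul']
  split_ifs with hj
  · obtain ⟨i, rfl⟩ := Nat.exists_eq_add_of_le hj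
    have h := h1 i
    rw [qx_pow_order_one hω hs, mul_comm m s, pow_mul ω s m, hω.pow_eq_one, one_pow, one_mul] at h
    rw [Nat.add_sub_cancel_left]
    rcases eq_or_ne ((X ^ s + 1 : k[X]).coeff i) 0 with h0 | h0
    · rw [h0] at h ⊢
      exact (mul_eq_zero.1 h).resolve_right (pow_ne_zero _ hω0)
    · have : ω ^ (m * i) = 1 := by
        have : i = 0 ∨ i = s := by
          by_contra hc
          push Not at hc
          apply h0
          rw [coeff_add, coeff_X_pow, coeff_one, if_neg hc.2, if_neg hc.1, add_zero]
        rcases this with rfl | rfl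
        · simp
        · rw [mul_comm, pow_mul, hω.pow_eq_one, one_pow]
      rw [← h, this, mul_one]
  · exact h2 j (not_le.1 hj)

theorem qx_expand_mul {ω : k} {s : ℕ} (hω : ω ^ s = 1) (f g : k[X]) :
    qx ω (expand k s f * g) = expand k s f * qx ω g := by
  rw [qx_apply, qx_apply, mul_comp, expand_eq_comp_X_pow, comp_assoc, X_pow_comp, mul_pow,
    ← C_pow, hω, C_1, one_mul]
  ring

theorem qx_pow_expand_mul {ω : k} {s : ℕ} (hω : ω ^ s = 1) (c : ℕ) (f g : k[X]) :
    (qx ω ^ c) (expand k s f * g) = expand k s f * (qx ω ^ c) g := by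
  induction c with
  | zero => simp
  | succ c ih =>
    rw [pow_succ', Module.End.mul_apply, ih, qx_expand_mul hω, Module.End.mul_apply]

theorem qx_pow_mul_order {ω : k} {s : ℕ} (hω : IsPrimitiveRoot ω s) (hs : 0 < s) (c : ℕ)
    (f : k[X]) : (qx ω ^ (c * s)) f = expand k s ((X + 1) ^ c) * f := by
  induction c with
  | zero => simp
  | succ c ih =>
    rw [add_mul, one_mul, add_comm, pow_add, Module.End.mul_apply, ih, qx_pow_order hω hs, pow_succ]
    simp
    ring

/-- The functional is multiplicative for the central subring `k[u^s, w^s]`, on which it is the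
evaluation at `u^s = -1`, `w^s = 1`. -/
theorem phi_expand_mul {ω : k} {s : ℕ} (hω : IsPrimitiveRoot ω s) (hs : 0 < s) (f g : k[X]) :
    phi ω (expand k s f * g) = f.eval (-1) * phi ω g := by
  have h1 : ∀ g, phi ω (X ^ s * g) = - phi ω g := by
    intro g
    have h := phi_qx ω ((qx ω ^ (s - 1)) g)
    rw [← Module.End.mul_apply, ← pow_succ', Nat.sub_add_cancel hs, qx_pow_order hω hs, add_mul,
      one_mul, map_add] at h
    exact eq_neg_of_add_eq_zero_left h
  induction f using Polynomial.induction_on' with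
  | add p q hp hq => rw [map_add, add_mul, map_add, hp, hq, eval_add, add_mul]
  | monomial m c =>
    rw [expand_monomial, eval_monomial]
    have h2 : phi ω (X ^ (s * m) * g) = (-1) ^ m * phi ω g := by
      induction m with
      | zero => simp
      | succ m ih => rw [mul_add, mul_one, add_comm, pow_add, mul_assoc, h1, ih, pow_succ]; ring
    rw [mul_comm m s, ← C_mul_X_pow_eq_monomial, mul_assoc, ← smul_eq_C_mul, map_smul, h2, smul_eq_mul]
    ring

end QuantumPlane

namespace QuantumPlane

open Polynomial

variable {k : Type u} [Field k]

theorem mul_mem_degreeLT {a b c : ℕ} {f g : k[X]} (hf : f ∈ degreeLT k (a + 1))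
    (hg : g ∈ degreeLT k b) (hc : a + b ≤ c) : f * g ∈ degreeLT k c := by
  rw [mem_degreeLT_iff_coeff] at *
  intro i hi
  rw [coeff_mul]
  refine Finset.sum_eq_zero fun p hp => ?_
  have := Finset.HasAntidiagonal.mem_antidiagonal.1 hp
  by_cases h : a + 1 ≤ p.1
  · rw [hf _ h, zero_mul]
  · rw [hg _ (by omega), mul_zero]

theorem expand_mem_degreeLT {s a : ℕ} (hs : 0 < s) {f : k[X]} (hf : f ∈ degreeLT k (a + 1)) :
    expand k s f ∈ degreeLT k (a * s + 1) := by
  rw [mem_degreeLT_iff_coeff] at *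
  intro i hi
  rw [coeff_expand hs]
  split_ifs with h
  · obtain ⟨m, rfl⟩ := h
    rw [Nat.mul_div_cancel_left _ hs]
    refine hf m ?_
    by_contra hc
    have : m * s ≤ a * s := Nat.mul_le_mul_right s (by omega)
    rw [mul_comm] at this
    omega
  · rfl

theorem expand_mul_mem_degreeLT {s a b c : ℕ} (hs : 0 < s) {f g : k[X]}
    (hf : f ∈ degreeLT k (a + 1)) (hg : g ∈ degreeLT k b) (hc : a * s + b ≤ c) :
    expand k s f * g ∈ degreeLT k c :=
  mul_mem_degreeLT (expand_mem_degreeLT hs hf) hg hc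

theorem expand_mul_mem_box_of_dvd {s N n t D α : ℕ} {f g : k[X]}
    (hf : X ^ N ∣ f) (hg : X ^ α ∣ g) (hn : n ≤ N * s + α) :
    expand k s f * g ∈ box n t D := by
  obtain ⟨f, rfl⟩ := hf
  obtain ⟨g, rfl⟩ := hg
  refine dvd_mem_box ((pow_dvd_pow X hn).trans ⟨expand k s f * g, ?_⟩)
  rw [map_mul, map_pow, expand_X, pow_add, ← pow_mul, mul_comm s N]
  ring

theorem expand_mul_mem_box_of_degreeLT {s T p n t j D β : ℕ} (hs : 0 < s) {f g : k[X]}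
    (hf : f ∈ degreeLT k (p + 1 - T)) (hg : g ∈ degreeLT k (j + 1 - β)) (ht : t ≤ T * s + β)
    (hD : D = p * s + j) :
    expand k s f * g ∈ box n t D := by
  rcases Nat.lt_or_ge p T with h | h
  · rw [Nat.sub_eq_zero_of_le (by omega)] at hf
    rw [degreeLT_zero_eq hf]; simp
  rcases Nat.lt_or_ge j β with h' | h'
  · rw [Nat.sub_eq_zero_of_le (by omega)] at hg
    rw [degreeLT_zero_eq hg]; simp
  obtain ⟨p, rfl⟩ := Nat.exists_eq_add_of_le h
  refine degreeLT_mem_box (expand_mul_mem_degreeLT (a := p) hs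
    (by convert hf using 2; omega) hg ?_)
  rw [add_mul] at hD
  omega

/-- If `f` is in `(U^N, W^T)` and `g` is divisible by `u^α` and by `w^β`, then `f(u^s, w^s) g` is in
`(u^n, w^t)` for `n ≤ N s + α` and `t ≤ T s + β`. -/
theorem expand_mul_mem_box {s N T p n t j D α β : ℕ} (hs : 0 < s) {f g : k[X]}
    (hf : f ∈ box N T p) (hgα : X ^ α ∣ g) (hgβ : g ∈ degreeLT k (j + 1 - β))
    (hn : n ≤ N * s + α) (ht : t ≤ T * s + β) (hD : D = p * s + j) :
    expand k s f * g ∈ box n t D := by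
  obtain ⟨f₁, f₂, rfl, h1, h2⟩ := exists_add_of_mem_box hf
  rw [map_add, add_mul]
  exact add_mem (expand_mul_mem_box_of_dvd h1 hgα hn)
    (expand_mul_mem_box_of_degreeLT hs h2 hgβ ht hD)

theorem X_pow_dvd_of_dvd_qx {ω : k} (hω : ω ≠ 0) {m : ℕ} {f : k[X]} (h : X ^ m ∣ qx ω f) : X ^ m ∣ f := by
  rw [X_pow_dvd_iff] at *
  intro i
  induction i with
  | zero => intro hi; rw [← coeff_qx_zero ω, h 0 hi]
  | succ i ih =>
    intro hi
    have := h (i + 1) hi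
    rw [coeff_qx_succ, ih (by omega), zero_add] at this
    exact (mul_eq_zero.1 this).resolve_left (pow_ne_zero _ hω)

theorem X_pow_dvd_qx_pow (ω : k) {m : ℕ} {f : k[X]} (h : X ^ m ∣ f) (c : ℕ) :
    X ^ m ∣ (qx ω ^ c) f := by
  induction c with
  | zero => simpa using h
  | succ c ih =>
    rw [pow_succ', Module.End.mul_apply]
    rw [X_pow_dvd_iff] at *
    rintro (_ | i) hi
    · rw [coeff_qx_zero, ih 0 hi]
    · rw [coeff_qx_succ, ih i (by omega), ih (i + 1) hi]; simp

theorem mem_degreeLT_of_qx {ω : k} {m : ℕ} {f : k[X]} (h : qx ω f ∈ degreeLT k (m + 1)) :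
    f ∈ degreeLT k m := by
  rw [mem_degreeLT_iff_coeff] at *
  obtain ⟨N, hN⟩ : ∃ N, ∀ i, N ≤ i → f.coeff i = 0 :=
    ⟨f.natDegree + 1, fun i hi => coeff_eq_zero_of_natDegree_lt hi⟩
  suffices H : ∀ j i, N ≤ i + j → m ≤ i → f.coeff i = 0 from fun i hi => H N i (by omega) hi
  intro j
  induction j with
  | zero => exact fun i h1 _ => hN i (by omega)
  | succ j ih =>
    intro i h1 h2
    have := h (i + 1) (by omega)
    rwa [coeff_qx_succ, ih (i + 1) (by omega) (by omega), mul_zero, add_zero] at this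

/-- A generator `g` of degree `j` with `x^c g = h₁ + h₂`, where `h₁` is divisible by `u^l'` and `h₂`
by `w^l`, such that neither `g` nor `h₁` is in the image of `x`. The `k[x, W]`-submodule spanned by
`g` and `h₁` is a rank two piece of the quantum plane compatible with both `(u^n)` and `(w^t)`. -/
structure LinkedPair (ω : k) (l' l j c : ℕ) (g h₁ h₂ : k[X]) : Prop where
  mem : g ∈ degreeLT k (j + 1)
  mem₁ : h₁ ∈ degreeLT k (j + c + 1)
  mem₂ : h₂ ∈ degreeLT k (j + c + 1 - l)
  dvd₁ : X ^ l' ∣ h₁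
  eq : (qx ω ^ c) g = h₁ + h₂
  phi_ne : phi ω g ≠ 0
  phi_ne₁ : phi ω h₁ ≠ 0

/-- If `h₁` were a multiple of `x`, then `x^(c-1) g` would already be in `(u^l', w^l)`, because `x`
is injective modulo `u^l'` and modulo `w^l`; this contradicts the Lefschetz property. -/
theorem exists_linkedPair {ω : k} {s : ℕ} (hω : IsPrimitiveRoot ω s) {l l' j c : ℕ}
    (hjl : j < l) (hjl' : j < l') (hj : l + l' ≤ s + j) (hc : l + l' = 2 * j + 1 + c)
    (hs : 0 < s) : ∃ g h₁ h₂ : k[X], LinkedPair ω l' l j c g h₁ h₂ := by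
  have hω0 : ω ≠ 0 := hω.ne_zero hs.ne'
  obtain ⟨g, hg, hphi, hbox⟩ := exists_primitive hω0 (e := j) (N := l') (T := l) (c := c)
    (by omega) (by omega) (by omega) (fun m h1 h2 => qnum_ne_zero hω h1 (by omega))
  obtain ⟨h₁, h₂, heq, h1, h2⟩ := exists_add_of_mem_box hbox
  have hg1 := qx_pow_mem_degreeLT ω hg c
  have hphi0 : phi ω g ≠ 0 := by rw [hphi]; exact one_ne_zero
  have hm1 : h₁ ∈ degreeLT k (j + c + 1) := by
    rw [← add_sub_cancel_right h₁ h₂, ← heq]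
    refine sub_mem (by convert hg1 using 2; omega) ?_
    exact degreeLT_mono (by omega) h2
  refine ⟨g, h₁, h₂, hg, hm1, h2, h1, heq, hphi0, fun h0 => ?_⟩
  obtain ⟨c, rfl⟩ : ∃ c', c = c' + 1 := ⟨c - 1, by omega⟩
  obtain ⟨y, hy, rfl⟩ := exists_eq_qx_of_phi_eq_zero hm1 h0
  have h1' := X_pow_dvd_of_dvd_qx hω0 h1
  have hy' : (qx ω ^ c) g - y ∈ degreeLT k (j + c + 1 - l) := by
    apply mem_degreeLT_of_qx (ω := ω)
    rw [map_sub, ← Module.End.mul_apply, ← pow_succ', heq, add_sub_cancel_left]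
    convert h2 using 2; omega
  have hg0 : g = 0 := by
    refine eq_zero_of_qx_pow_mem_box hω0 (e := j) (N := l') (T := l) (c := c)
      (by omega) (by omega) (by omega) (fun m h1 h2 => qnum_ne_zero hω h1 (by omega)) hg ?_
    rw [← add_sub_cancel y ((qx ω ^ c) g)]
    exact add_mem (dvd_mem_box h1') (degreeLT_mem_box hy')
  rw [hg0, map_zero] at hphi0
  exact hphi0 rfl

/-- The case `ω = 1` of `exists_primitive`, in the commutative ring `k[U, W]`. -/
theorem exists_primitive_classical [CharZero k] {e N T c : ℕ} (hNT : N + T = 2 * e + 1 + c)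
    (hN : e ≤ N) (hT : e ≤ T) :
    ∃ f ∈ degreeLT k (e + 1), f.eval (-1) = 1 ∧ (X + 1) ^ c * f ∈ box N T (e + c) := by
  obtain ⟨f, hf, h1, h2⟩ := exists_primitive (one_ne_zero (α := k)) hNT hN hT
    fun m hm _ => qnum_one_ne_zero hm
  rw [phi_one_left] at h1
  rw [qx_pow_one_apply] at h2
  exact ⟨f, hf, h1, h2⟩

/-- The module `k⟨u, w⟩/(u^n, w^t)` has an element `b` of degree `d` outside the image of `x`, hence a
minimal generator over `k[x]`, such that `x^L b = 0`. -/
def HasString (ω : k) (n t d L : ℕ) : Prop :=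
  ∃ b ∈ degreeLT k (d + 1), phi ω b ≠ 0 ∧ (qx ω ^ L) b ∈ box n t (d + L)

/-- A rank one piece: the primitive elements of `k[U, W]/(U^N, W^T)` times a fixed `g` of degree `j`. -/
theorem hasString_of_free [CharZero k] {ω : k} {s : ℕ} (hω : IsPrimitiveRoot ω s) (hs : 0 < s)
    {N T i c n t j α β : ℕ} {g : k[X]} (hNT : N + T = 2 * i + 1 + c) (hN : i ≤ N) (hT : i ≤ T)
    (hg : phi ω g ≠ 0) (hgj : g ∈ degreeLT k (j + 1)) (hgα : X ^ α ∣ g)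
    (hgβ : g ∈ degreeLT k (j + 1 - β)) (hn : n ≤ N * s + α) (ht : t ≤ T * s + β) :
    HasString ω n t (i * s + j) (c * s) := by
  obtain ⟨f, hf, h1, h2⟩ := exists_primitive_classical (k := k) hNT hN hT
  refine ⟨expand k s f * g, expand_mul_mem_degreeLT hs hf hgj (by omega), ?_, ?_⟩
  · rw [phi_expand_mul hω hs, h1, one_mul]; exact hg
  · rw [qx_pow_mul_order hω hs, ← mul_assoc, ← map_mul]
    exact expand_mul_mem_box hs h2 hgα hgβ hn ht (by ring)

/-- In a rank two piece, the strings that start in degrees congruent to that of `g`. In the degrees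
congruent to that of `h₁`, the piece splits as `k[U, W]/(U^r', W^(r+1)) h₁ ⊕
k[U, W]/(U^(r'+1), W^r) h₂`, and the generator combines primitive elements `f₁`, `f₂` of the two
summands, which agree modulo `U + W` once they are normalized. -/
theorem hasString_of_linkedPair_lower [CharZero k] {ω : k} {s : ℕ} (hω : IsPrimitiveRoot ω s)
    (hs : 0 < s) {r r' l l' j c i C : ℕ} {g h₁ h₂ : k[X]} (H : LinkedPair ω l' l j c g h₁ h₂)
    (hl : l ≤ s) (hl' : l' ≤ s)
    (hcs : c < s) (hr : i ≤ r) (hr' : i ≤ r') (hC : r + r' = 2 * i + C) :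
    HasString ω (r' * s + l') (r * s + l) (i * s + j) (C * s + c) := by
  obtain ⟨f₁, hf₁, he₁, hb₁⟩ := exists_primitive_classical (k := k) (e := i) (N := r') (T := r + 1)
    (c := C) (by omega) (by omega) (by omega)
  obtain ⟨f₂, hf₂, he₂, hb₂⟩ := exists_primitive_classical (k := k) (e := i) (N := r' + 1) (T := r)
    (c := C) (by omega) (by omega) (by omega)
  obtain ⟨p, hp, hpe⟩ := exists_eq_qx_of_phi_eq_zero (ω := (1 : k)) (sub_mem hf₁ hf₂)
    (by rw [phi_one_left, eval_sub, he₁, he₂, sub_self])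
  have hpe : f₁ = f₂ + (X + 1) * p := by
    rw [← pow_one (X + 1), ← qx_pow_one_apply, pow_one, ← hpe]; ring
  refine ⟨expand k s f₂ * g + expand k s p * (qx ω ^ (s - c)) h₁, add_mem ?_ ?_, ?_, ?_⟩
  · exact expand_mul_mem_degreeLT hs hf₂ H.mem (by omega)
  · rcases i with _ | i
    · rw [degreeLT_zero_eq hp]; simp
    · exact expand_mul_mem_degreeLT hs hp (qx_pow_mem_degreeLT ω H.mem₁ _)
        (by rw [add_mul]; omega)
  · rw [map_add, phi_expand_mul hω hs, phi_expand_mul hω hs, he₂,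
      show s - c = (s - c - 1) + 1 by omega, pow_succ', Module.End.mul_apply, phi_qx]
    simpa using H.phi_ne
  · -- `x^c · x^(s-c) = U + W` turns the correction term into `f₁ - f₂`
    have key : (qx ω ^ (C * s + c)) (expand k s f₂ * g + expand k s p * (qx ω ^ (s - c)) h₁) =
        expand k s ((X + 1) ^ C * f₁) * h₁ + expand k s ((X + 1) ^ C * f₂) * h₂ := by
      rw [pow_add, Module.End.mul_apply, qx_pow_mul_order hω hs, map_add,
        qx_pow_expand_mul hω.pow_eq_one, qx_pow_expand_mul hω.pow_eq_one, H.eq,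
        ← Module.End.mul_apply, ← pow_add, show c + (s - c) = s by omega, qx_pow_order hω hs, hpe]
      simp only [map_mul, map_add, expand_X, map_one, map_pow]
      ring
    rw [key]
    refine add_mem ?_ ?_
    · exact expand_mul_mem_box hs hb₁ H.dvd₁ (β := 0) (j := j + c) H.mem₁ (by omega)
        (by rw [add_mul]; omega) (by ring)
    · exact expand_mul_mem_box hs hb₂ (α := 0) (by simp) H.mem₂ (by rw [add_mul]; omega)
        (by omega) (by ring)

/-- In a rank two piece, the strings that start in degrees congruent to that of `h₁`. The generator is
a primitive element of `k[U, W]/(U^r', W^r)` times `h₁`, corrected by a multiple of `x^c g` found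
from the Lefschetz property of `k[U, W]/(U^(r'+1), W^(r+1))`. -/
theorem hasString_of_linkedPair_upper [CharZero k] {ω : k} {s : ℕ} (hω : IsPrimitiveRoot ω s)
    (hs : 0 < s) {r r' l l' j c i C : ℕ} {g h₁ h₂ : k[X]} (H : LinkedPair ω l' l j c g h₁ h₂)
    (hl : l ≤ s) (hl' : l' ≤ s) (hc : 0 < c)
    (hlj : l ≤ j + c) (hcs : c < s) (hr : i < r) (hr' : i < r') (hC : r + r' = 2 * i + 1 + C) :
    HasString ω (r' * s + l') (r * s + l) (i * s + (j + c)) (C * s + (s - c)) := by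
  obtain ⟨f, hf, he, hb⟩ := exists_primitive_classical (k := k) (e := i) (N := r') (T := r)
    (c := C) (by omega) (by omega) (by omega)
  obtain ⟨δ, γ, hδγ, hδ, hγ⟩ := exists_add_of_mem_box hb
  obtain ⟨p, hp, hpb⟩ := exists_qx_pow_sub_mem_box (one_ne_zero (α := k)) (e := i) (N := r' + 1)
    (T := r + 1) (c := C + 1) (by omega) (by omega) (by omega)
    (fun m hm _ => qnum_one_ne_zero hm) (-((X + 1) * γ))
  rw [qx_pow_one_apply, sub_neg_eq_add] at hpb
  refine ⟨expand k s f * h₁ + expand k s p * (qx ω ^ c) g, add_mem ?_ ?_, ?_, ?_⟩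
  · exact expand_mul_mem_degreeLT hs hf H.mem₁ (by omega)
  · exact expand_mul_mem_degreeLT hs hp (qx_pow_mem_degreeLT ω H.mem _) (by omega)
  · rw [map_add, phi_expand_mul hω hs, phi_expand_mul hω hs, he,
      show c = (c - 1) + 1 by omega, pow_succ', Module.End.mul_apply, phi_qx]
    simpa using H.phi_ne₁
  · -- `x^(s-c) h₁ + x^(s-c) h₂ = (U + W) g` moves the part `γ` of `(U + W)^C f` divisible by `W^r`
    -- from `h₁` to `h₂`, at the cost of a multiple of `g` that `p` cancels
    have hsum : (qx ω ^ (s - c)) h₁ + (qx ω ^ (s - c)) h₂ = (X ^ s + 1) * g := by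
      rw [← map_add, ← H.eq, ← Module.End.mul_apply, ← pow_add, Nat.sub_add_cancel hcs.le,
        qx_pow_order hω hs]
    have key : (qx ω ^ (C * s + (s - c))) (expand k s f * h₁ + expand k s p * (qx ω ^ c) g) =
        expand k s δ * (qx ω ^ (s - c)) h₁ +
          expand k s ((X + 1) ^ (C + 1) * p + (X + 1) * γ) * g -
            expand k s γ * (qx ω ^ (s - c)) h₂ := by
      rw [pow_add, Module.End.mul_apply, qx_pow_mul_order hω hs, map_add,
        qx_pow_expand_mul hω.pow_eq_one, qx_pow_expand_mul hω.pow_eq_one,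
        ← Module.End.mul_apply (qx ω ^ (s - c)), ← pow_add, Nat.sub_add_cancel hcs.le,
        qx_pow_order hω hs, mul_add, ← mul_assoc, ← map_mul, hδγ]
      simp only [map_mul, map_add, expand_X, map_one, map_pow]
      linear_combination (expand k s γ) * hsum
    rw [key]
    refine sub_mem (add_mem ?_ ?_) ?_
    · exact expand_mul_mem_box_of_dvd hδ (X_pow_dvd_qx_pow ω H.dvd₁ _) le_rfl
    · exact expand_mul_mem_box hs hpb (α := 0) (β := 0) (by simp) H.mem (by rw [add_mul]; omega)
        (by rw [add_mul]; omega) (by rw [← add_assoc, add_mul, add_mul]; omega)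
    · refine expand_mul_mem_box_of_degreeLT (j := j + s) (β := l) hs hγ ?_ le_rfl
        (by rw [add_mul]; omega)
      exact degreeLT_mono (by omega) (qx_pow_mem_degreeLT ω H.mem₂ _)

/-- The length of the string that starts in degree `i s + j` of the tensor product of modules of
dimensions `r' s + l'` and `r s + l`. In the first branch, `l + l' - s` is truncated to `0` when
`l + l' ≤ s`. -/
def stringLength (s r r' l l' : ℕ) (i j : ℕ) : ℕ :=
  if j < l + l' - s then (r + r' + 1 - 2 * i) * s
  else if j < min l l' then r' * s + l' + (r * s + l) - 1 - 2 * i * s - 2 * j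
  else if j < max l l' then (r + r' - 2 * i) * s
  else if j < l + l' then r' * s + l' + (r * s + l) - 1 - 2 * i * s - 2 * j
  else (r + r' - 1 - 2 * i) * s

theorem hasString_stringLength [CharZero k] {ω : k} {s : ℕ} (hω : IsPrimitiveRoot ω s) (hs : 0 < s)
    {r r' l l' i j : ℕ} (hl : l < s) (hl' : l' < s) (htn : r * s + l ≤ r' * s + l') (hj : j < s)
    (hd : i * s + j < r * s + l) :
    HasString ω (r' * s + l') (r * s + l) (i * s + j) (stringLength s r r' l l' i j) := by
  have hω0 : ω ≠ 0 := hω.ne_zero hs.ne'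
  have hlex : ∀ {a b x y : ℕ}, x < s → y < s → a * s + x ≤ b * s + y → a ≤ b ∧ (y < x → a < b) := by
    intro a b x y hx hy h
    constructor
    · by_contra hc
      have : (b + 1) * s ≤ a * s := Nat.mul_le_mul_right s (by omega)
      rw [add_mul] at this; omega
    · intro hyx
      by_contra hc
      have : b * s ≤ a * s := Nat.mul_le_mul_right s (by omega)
      omega
  obtain ⟨hr, hr1⟩ := hlex hl hl' htn
  obtain ⟨hi, hi1⟩ := hlex hj hl hd.le
  have hi2 : l ≤ j → i < r := by
    intro h
    rcases h.lt_or_eq with h | rfl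
    · exact hi1 h
    · exact lt_of_mul_lt_mul_right (by omega : i * s < r * s) (Nat.zero_le s)
  have h1j : ∀ m, 0 < m → (1 : k[X]) ∈ degreeLT k m := fun m hm => one_mem_degreeLT hm
  have hXj : ∀ {a m : ℕ}, a < m → (X ^ a : k[X]) ∈ degreeLT k m := by
    intro a m h
    rw [mem_degreeLT, degree_X_pow]; exact_mod_cast h
  have hphi1 : phi ω 1 ≠ 0 := by rw [phi_one]; exact one_ne_zero
  unfold stringLength
  split_ifs with c1 c2 c3 c4
  · exact hasString_of_free hω hs (N := r' + 1) (T := r + 1) (α := 0) (β := 0) (g := 1)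
      (by omega) (by omega) (by omega) hphi1 (h1j _ (by omega)) (by simp) (h1j _ (by omega))
      (by rw [add_mul]; omega) (by rw [add_mul]; omega)
  · rw [lt_min_iff] at c2
    obtain ⟨c, hc⟩ : ∃ c, l + l' = 2 * j + 1 + c := ⟨l + l' - (2 * j + 1), by omega⟩
    obtain ⟨g, h₁, h₂, H⟩ := exists_linkedPair hω c2.1 c2.2 (by omega) hc hs
    obtain ⟨C, hC⟩ : ∃ C, r + r' = 2 * i + C := ⟨r + r' - 2 * i, by omega⟩
    have := hasString_of_linkedPair_lower hω hs H hl.le hl'.le (by omega) hi (by omega) hC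
    convert this using 1
    have : r * s + r' * s = 2 * i * s + C * s := by rw [← add_mul, hC, add_mul]
    omega
  · rw [lt_min_iff, not_and_or, not_lt, not_lt] at c2
    rw [lt_max_iff] at c3
    rcases Nat.lt_or_ge j l with h | h
    · exact hasString_of_free hω hs (N := r') (T := r + 1) (α := j) (β := 0) (g := X ^ j)
        (by omega) (by omega) (by omega) (phi_X_pow_ne_zero hω0 j) (hXj (by omega)) dvd_rfl
        (hXj (by omega)) (by omega) (by rw [add_mul]; omega)
    · have := hi2 h
      exact hasString_of_free hω hs (N := r' + 1) (T := r) (α := 0) (β := j) (g := 1)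
        (by omega) (by omega) (by omega) hphi1 (h1j _ (by omega)) (by simp) (h1j _ (by omega))
        (by rw [add_mul]; omega) (by omega)
  · rw [lt_max_iff, not_or, not_lt, not_lt] at c3
    have hir := hi2 c3.1
    -- the string belongs to the piece whose generator has degree `l + l' - 1 - j`
    obtain ⟨j', hj'⟩ : ∃ j', l + l' = j' + j + 1 := ⟨l + l' - 1 - j, by omega⟩
    obtain ⟨c, hc⟩ : ∃ c, j = j' + c := ⟨j - j', by omega⟩
    subst hc
    obtain ⟨g, h₁, h₂, H⟩ := exists_linkedPair hω (l := l) (l' := l') (j := j') (c := c)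
      (by omega) (by omega) (by omega) (by omega) hs
    obtain ⟨C, hC⟩ : ∃ C, r + r' = 2 * i + 1 + C := ⟨r + r' - 2 * i - 1, by omega⟩
    have := hasString_of_linkedPair_upper hω hs H hl.le hl'.le (by omega) c3.1 (by omega) hir
      (by omega) hC
    convert this using 1
    have : r * s + r' * s = 2 * i * s + s + C * s := by rw [← add_mul, hC, add_mul, add_mul, one_mul]
    omega
  · rw [lt_max_iff, not_or, not_lt, not_lt] at c3
    have hir := hi2 c3.1
    exact hasString_of_free hω hs (N := r') (T := r) (α := l') (β := l) (g := X ^ l')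
      (by omega) (by omega) (by omega) (phi_X_pow_ne_zero hω0 _) (hXj (by omega)) dvd_rfl
      (hXj (by omega)) le_rfl le_rfl

end QuantumPlane

/-! ### Modules over `H` generated by strings -/

namespace HopfOre

variable {k : Type u} {G : Type v} [Field k] [Group G] {χ : G →* kˣ} {a : Subgroup.center G}

/-- `H` is generated by `G` and `x`. -/
theorem mem_subalgebra_of_generators {S : Subalgebra k (HopfOre χ a)} (hG : ∀ g, of χ a g ∈ S)
    (hX : X χ a ∈ S) (h : HopfOre χ a) : h ∈ S := by
  let f : G →* S :=
    { toFun := fun g => ⟨of χ a g, hG g⟩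
      map_one' := Subtype.ext (map_one _)
      map_mul' := fun g g' => Subtype.ext (map_mul _ g g') }
  let φ : HopfOre χ a →ₐ[k] S := lift f ⟨X χ a, hX⟩ fun g => Subtype.ext (X_mul_of χ a g)
  have hφ : S.val.comp φ = AlgHom.id k _ := by
    apply algHom_ext
    · intro g; simp [φ, f]
    · simp [φ]
  have := AlgHom.congr_fun hφ h
  simp only [AlgHom.comp_apply, AlgHom.id_apply] at this
  rw [← this]
  exact (φ h).2

theorem of_mul_X (g : G) : of χ a g * X χ a = ((χ g : kˣ) : k) • (X χ a * of χ a g) := by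
  rw [X_mul_of, smul_smul, MonoidHom.inv_apply, ← Units.val_mul, mul_inv_cancel, Units.val_one,
    one_smul]

theorem of_mul_X_pow (g : G) (p : ℕ) :
    of χ a g * X χ a ^ p = ((χ g ^ p : kˣ) : k) • (X χ a ^ p * of χ a g) := by
  induction p with
  | zero => simp
  | succ p ih =>
    rw [pow_succ, ← mul_assoc, ih, smul_mul_assoc, mul_assoc, of_mul_X, mul_smul_comm, smul_smul,
      mul_assoc, pow_succ, Units.val_mul]

end HopfOre

namespace NilMod

variable {k : Type u} {G : Type v} [Field k] [Group G] (χ : G →* kˣ) (a : Subgroup.center G)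
  (t : ℕ) (μ : G →* kˣ)

instance : Module.Finite k (NilMod χ a t μ) := inferInstanceAs (Module.Finite k (Fin t → k))

instance : Module.Free k (NilMod χ a t μ) := inferInstanceAs (Module.Free k (Fin t → k))

theorem finrank_eq : Module.finrank k (NilMod χ a t μ) = t := Module.finrank_fin_fun k

/-- The vector `m_i`, which is zero for `i ≥ t`. -/
def vec (i : ℕ) : NilMod χ a t μ := if h : i < t then basisVec χ a t μ ⟨i, h⟩ else 0

theorem vec_of_le {i : ℕ} (h : t ≤ i) : vec χ a t μ i = 0 := dif_neg (not_lt.2 h)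

theorem of_smul_vec (g : G) (i : ℕ) :
    HopfOre.of χ a g • vec χ a t μ i = (((χ g) ^ i * μ g : kˣ) : k) • vec χ a t μ i := by
  unfold vec
  split_ifs with h
  · exact of_smul_basisVec χ a t μ g ⟨i, h⟩
  · rw [smul_zero, smul_zero]

theorem X_smul_vec (i : ℕ) : HopfOre.X χ a • vec χ a t μ i = vec χ a t μ (i + 1) := by
  unfold vec
  split_ifs with h h' h'
  · rw [X_smul_basisVec, dif_pos h']
  · rw [X_smul_basisVec, dif_neg h']
  · omega
  · rw [smul_zero]

theorem sum_smul_vec (f : Fin t → k) :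
    ∑ i : Fin t, f i • vec χ a t μ i = (f : NilMod χ a t μ) := by
  have h : ∀ i : Fin t, vec χ a t μ i = (Pi.single i 1 : Fin t → k) := fun i => dif_pos i.2
  simp only [h]
  exact (pi_eq_sum_univ' f).symm

theorem span_vec : Submodule.span k (Set.range (vec χ a t μ)) = ⊤ := by
  rw [eq_top_iff]
  intro f _
  rw [← sum_smul_vec χ a t μ f]
  exact Submodule.sum_mem _ fun i _ => Submodule.smul_mem _ _ (Submodule.subset_span ⟨i, rfl⟩)

variable {χ a t μ}

variable {M : Type w} [AddCommGroup M] [Module k M] [Module (HopfOre χ a) M]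
  [IsScalarTower k (HopfOre χ a) M]

/-- The universal property of `V_t(μ)`: it maps to any module with a vector of weight `μ` killed by
`x^t`. -/
theorem exists_linearMap {b : M} (hb : ∀ g, HopfOre.of χ a g • b = ((μ g : kˣ) : k) • b)
    (hX : HopfOre.X χ a ^ t • b = 0) :
    ∃ F : NilMod χ a t μ →ₗ[HopfOre χ a] M, b ∈ LinearMap.range F := by
  let F : NilMod χ a t μ →ₗ[k] M :=
    ∑ i : Fin t, (LinearMap.proj (R := k) (φ := fun _ : Fin t => k) i).smulRight
      (HopfOre.X χ a ^ (i : ℕ) • b)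
  have hF : ∀ i, F (vec χ a t μ i) = HopfOre.X χ a ^ i • b := by
    intro i
    unfold vec
    split_ifs with h
    · change (∑ j : Fin t, (LinearMap.proj (R := k) (φ := fun _ : Fin t => k) j).smulRight
        (HopfOre.X χ a ^ (j : ℕ) • b)) (Pi.single ⟨i, h⟩ 1 : Fin t → k) = _
      rw [LinearMap.sum_apply, Finset.sum_eq_single ⟨i, h⟩]
      · simp
      · intro j _ hj
        simp [Pi.single_eq_of_ne hj]
      · simp
    · obtain ⟨m, rfl⟩ := Nat.exists_eq_add_of_le' (not_lt.1 h)
      rw [map_zero, pow_add, mul_smul, hX, smul_zero]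
  let S : Subalgebra k (HopfOre χ a) :=
    { carrier := {h | ∀ f, F (h • f) = h • F f}
      mul_mem' := fun {x y} hx hy f => by rw [mul_smul, hx, hy, mul_smul]
      add_mem' := fun {x y} hx hy f => by rw [add_smul, map_add, hx, hy, add_smul]
      algebraMap_mem' := fun c f => by rw [algebraMap_smul, algebraMap_smul, map_smul] }
  have ext : ∀ h : HopfOre χ a, (∀ i, F (h • vec χ a t μ i) = h • F (vec χ a t μ i)) → h ∈ S := by
    intro h hi f
    have hf : f ∈ Submodule.span k (Set.range (vec χ a t μ)) := by rw [span_vec]; trivial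
    induction hf using Submodule.span_induction with
    | mem x hx => obtain ⟨i, rfl⟩ := hx; exact hi i
    | zero => simp
    | add x y _ _ hx hy => rw [smul_add, map_add, hx, hy, map_add, smul_add]
    | smul c x _ hx => rw [smul_comm, map_smul, hx, map_smul, smul_comm]
  have hS : ∀ h, h ∈ S := by
    apply HopfOre.mem_subalgebra_of_generators
    · intro g
      refine ext _ fun i => ?_
      rw [of_smul_vec, map_smul, hF, ← mul_smul, HopfOre.of_mul_X_pow, smul_assoc, mul_smul, hb,
        smul_comm (HopfOre.X χ a ^ i), smul_smul, Units.val_mul]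
    · refine ext _ fun i => ?_
      rw [X_smul_vec, hF, hF, pow_succ', mul_smul]
  exact ⟨{ toFun := F, map_add' := map_add F, map_smul' := hS }, vec χ a t μ 0, by
    change F _ = _
    rw [hF, pow_zero, one_smul]⟩

end NilMod

section NilSum

variable {k : Type u} {G : Type v} [Field k] [Group G] {χ : G →* kˣ} {a : Subgroup.center G}
  {M : Type w} [AddCommGroup M] [Module k M] [Module (HopfOre χ a) M]
  [IsScalarTower k (HopfOre χ a) M] {μ : G →* kˣ}

theorem NilSum.finrank_eq (I J : Finset ℕ) (d : ℕ → ℕ → ℕ) :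
    Module.finrank k (NilSum χ a μ I J d) = ∑ i ∈ I, ∑ j ∈ J, d i j := by
  rw [Module.finrank_directSum, ← Finset.sum_coe_sort I]
  refine Finset.sum_congr rfl fun i _ => ?_
  rw [Module.finrank_directSum, ← Finset.sum_coe_sort J]
  exact Finset.sum_congr rfl fun j _ => NilMod.finrank_eq _ _ _ _

theorem NilSum.exists_linearMap {I J : Finset ℕ} {d : ℕ → ℕ → ℕ} {b : ℕ → ℕ → M}
    (hb : ∀ i ∈ I, ∀ j ∈ J, ∀ g, HopfOre.of χ a g • b i j = (((χ ^ j * μ) g : kˣ) : k) • b i j)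
    (hX : ∀ i ∈ I, ∀ j ∈ J, HopfOre.X χ a ^ d i j • b i j = 0) :
    ∃ F : NilSum χ a μ I J d →ₗ[HopfOre χ a] M, ∀ i ∈ I, ∀ j ∈ J, b i j ∈ LinearMap.range F := by
  have h : ∀ (i : I) (j : J), ∃ F : NilMod χ a (d i j) (χ ^ (j : ℕ) * μ) →ₗ[HopfOre χ a] M,
      b i j ∈ LinearMap.range F := fun i j =>
    NilMod.exists_linearMap (hb i i.2 j j.2) (hX i i.2 j j.2)
  choose F hF using h
  refine ⟨DirectSum.toModule _ _ _ fun i => DirectSum.toModule _ _ _ fun j => F i j,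
    fun i hi j hj => ?_⟩
  obtain ⟨x, hx⟩ := hF ⟨i, hi⟩ ⟨j, hj⟩
  refine ⟨DirectSum.lof (HopfOre χ a) I _ ⟨i, hi⟩ (DirectSum.lof (HopfOre χ a) J _ ⟨j, hj⟩ x), ?_⟩
  rw [DirectSum.toModule_lof, DirectSum.toModule_lof, hx]

variable (χ a M μ) in
/-- Vectors `b 0, …, b (t - 1)` that generate `M` as an `H`-module, `b d` having weight `χ^d μ` and
being killed by `x^(L d)`. -/
structure IsStringSystem (t : ℕ) (L : ℕ → ℕ) (b : ℕ → M) : Prop where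
  weight : ∀ d g, HopfOre.of χ a g • b d = (((χ g) ^ d * μ g : kˣ) : k) • b d
  nilp : ∀ d < t, HopfOre.X χ a ^ L d • b d = 0
  generates : ∀ S : Submodule (HopfOre χ a) M, (∀ d < t, b d ∈ S) → S = ⊤

/-- The pairs in `I × J` stand for starting degrees `i s + j < t`, and `d i j` is the length `L` of the
string that starts there. -/
def IsStringBlock (s t : ℕ) (L : ℕ → ℕ) (I J : Finset ℕ) (d : ℕ → ℕ → ℕ) : Prop :=
  ∀ i ∈ I, ∀ j ∈ J, i * s + j < t ∧ d i j = L (i * s + j)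

theorem IsStringSystem.exists_linearMap {s t : ℕ} {L : ℕ → ℕ} {b : ℕ → M}
    (hb : IsStringSystem χ a M μ t L b) (hs : χ ^ s = 1) {I J : Finset ℕ} {d : ℕ → ℕ → ℕ}
    (h : IsStringBlock s t L I J d) :
    ∃ F : NilSum χ a μ I J d →ₗ[HopfOre χ a] M,
      ∀ i ∈ I, ∀ j ∈ J, b (i * s + j) ∈ LinearMap.range F := by
  refine NilSum.exists_linearMap (b := fun i j => b (i * s + j)) (fun i hi j hj g => ?_)
    fun i hi j hj => ?_
  · have hχ : χ g ^ (i * s + j) = χ g ^ j := by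
      rw [pow_add, mul_comm i s, pow_mul, ← MonoidHom.pow_apply χ s, hs, MonoidHom.one_apply,
        one_pow, one_mul]
    rw [hb.weight, hχ]; rfl
  · rw [(h i hi j hj).2]; exact hb.nilp _ (h i hi j hj).1

/-- The strings give a surjection from the direct sum onto `M`, which is bijective as soon as the
dimensions agree. -/
theorem IsStringSystem.nonempty_equiv [Module.Finite k M] {s t : ℕ} {L : ℕ → ℕ} {b : ℕ → M}
    (hb : IsStringSystem χ a M μ t L b) (hs : χ ^ s = 1)
    {I₁ J₁ I₂ J₂ I₃ J₃ I₄ J₄ : Finset ℕ} {d₁ d₂ d₃ d₄ : ℕ → ℕ → ℕ}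
    (h₁ : IsStringBlock s t L I₁ J₁ d₁) (h₂ : IsStringBlock s t L I₂ J₂ d₂)
    (h₃ : IsStringBlock s t L I₃ J₃ d₃) (h₄ : IsStringBlock s t L I₄ J₄ d₄)
    (hcover : ∀ d < t, ∃ i j, d = i * s + j ∧
      (i ∈ I₁ ∧ j ∈ J₁ ∨ i ∈ I₂ ∧ j ∈ J₂ ∨ i ∈ I₃ ∧ j ∈ J₃ ∨ i ∈ I₄ ∧ j ∈ J₄))
    (hrank : ∑ i ∈ I₁, ∑ j ∈ J₁, d₁ i j + (∑ i ∈ I₂, ∑ j ∈ J₂, d₂ i j +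
      (∑ i ∈ I₃, ∑ j ∈ J₃, d₃ i j + ∑ i ∈ I₄, ∑ j ∈ J₄, d₄ i j)) = Module.finrank k M) :
    Nonempty (M ≃ₗ[HopfOre χ a] NilSum χ a μ I₁ J₁ d₁ × NilSum χ a μ I₂ J₂ d₂ ×
      NilSum χ a μ I₃ J₃ d₃ × NilSum χ a μ I₄ J₄ d₄) := by
  obtain ⟨F₁, hF₁⟩ := hb.exists_linearMap hs h₁
  obtain ⟨F₂, hF₂⟩ := hb.exists_linearMap hs h₂
  obtain ⟨F₃, hF₃⟩ := hb.exists_linearMap hs h₃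
  obtain ⟨F₄, hF₄⟩ := hb.exists_linearMap hs h₄
  let F := F₁.coprod (F₂.coprod (F₃.coprod F₄))
  have hsurj : Function.Surjective F := by
    rw [← LinearMap.range_eq_top]
    refine hb.generates _ fun d hd => ?_
    simp only [F, LinearMap.range_coprod]
    obtain ⟨i, j, rfl, h | h | h | h⟩ := hcover d hd
    · exact Submodule.mem_sup_left (hF₁ i h.1 j h.2)
    · exact Submodule.mem_sup_right (Submodule.mem_sup_left (hF₂ i h.1 j h.2))
    · exact Submodule.mem_sup_right (Submodule.mem_sup_right
        (Submodule.mem_sup_left (hF₃ i h.1 j h.2)))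
    · exact Submodule.mem_sup_right (Submodule.mem_sup_right
        (Submodule.mem_sup_right (hF₄ i h.1 j h.2)))
  have hinj : Function.Injective F := by
    refine (LinearMap.injective_iff_surjective_of_finrank_eq_finrank
      (f := F.restrictScalars k) ?_).2 hsurj
    rw [Module.finrank_prod, Module.finrank_prod, Module.finrank_prod, NilSum.finrank_eq,
      NilSum.finrank_eq, NilSum.finrank_eq, NilSum.finrank_eq, hrank]
  exact ⟨(LinearEquiv.ofBijective F ⟨hinj, hsurj⟩).symm⟩

end NilSum

/-! ### Realizing the quantum plane in a module -/

namespace QuantumPlane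

open Polynomial

section Realize

variable {k : Type u} [Field k] {M : Type w} [AddCommGroup M] [Module k M]

/-- The image in `M` of a form `∑ cᵢ uⁱ w^(d-i)` of degree `d`, encoded by the polynomial `∑ cᵢ Xⁱ`,
under `uⁱ w^j ↦ E i j`. -/
def realize (E : ℕ → ℕ → M) (d : ℕ) : k[X] →ₗ[k] M :=
  ∑ i ∈ Finset.range (d + 1), (lcoeff k i).smulRight (E i (d - i))

theorem realize_apply (E : ℕ → ℕ → M) (d : ℕ) (f : k[X]) :
    realize E d f = ∑ i ∈ Finset.range (d + 1), f.coeff i • E i (d - i) := by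
  simp [realize]

theorem realize_one (E : ℕ → ℕ → M) (d : ℕ) : realize E d (1 : k[X]) = E 0 d := by
  rw [realize_apply, Finset.sum_eq_single 0]
  · simp
  · intro i _ hi
    rw [coeff_one, if_neg hi, zero_smul]
  · simp

theorem realize_X_pow (E : ℕ → ℕ → M) (i j : ℕ) : realize E (i + j) (X ^ i : k[X]) = E i j := by
  rw [realize_apply, Finset.sum_eq_single i]
  · simp
  · intro m _ hm
    rw [coeff_X_pow, if_neg hm, zero_smul]
  · intro h; simp at h

theorem exists_add_smul_of_phi_ne_zero {ω : k} {d : ℕ} {b f : k[X]} (hb : b ∈ degreeLT k (d + 1))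
    (hphi : phi ω b ≠ 0) (hf : f ∈ degreeLT k (d + 1)) :
    ∃ g ∈ degreeLT k d, ∃ c : k, f = qx ω g + c • b := by
  obtain ⟨g, hg, h⟩ := exists_eq_qx_of_phi_eq_zero (ω := ω)
    (sub_mem hf (Submodule.smul_mem _ (phi ω f / phi ω b) hb))
    (by rw [map_sub, map_smul, smul_eq_mul, div_mul_cancel₀ _ hphi, sub_self])
  exact ⟨g, hg, _, by rw [← h, sub_add_cancel]⟩

theorem realize_eq_zero_of_mem_box {E : ℕ → ℕ → M} {n t d : ℕ}
    (hE : ∀ i j, n ≤ i ∨ t ≤ j → E i j = 0) {f : k[X]} (hf : f ∈ box n t d) :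
    realize E d f = 0 := by
  rw [realize_apply]
  refine Finset.sum_eq_zero fun i hi => ?_
  have hi := Finset.mem_range.1 hi
  by_cases h : i < n ∧ d < i + t
  · rw [hf i h.1 h.2, zero_smul]
  · rw [hE i (d - i) (by omega), smul_zero]

end Realize

variable {k : Type u} {G : Type v} [Field k] [Group G] {χ : G →* kˣ} {a : Subgroup.center G}
  {M : Type w} [AddCommGroup M] [Module k M] [Module (HopfOre χ a) M]
  [IsScalarTower k (HopfOre χ a) M] {μ : G →* kˣ}

variable (χ a μ) in
/-- A family `E i j` that spans `M` and exhibits it as a quotient of `k⟨u, w⟩/(u^n, w^t)`, `E i j`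
being the image of `uⁱ w^j`, with `x` acting by left multiplication and weight `χ^d μ` in
degree `d`. -/
structure IsGrid (ω : k) (n t : ℕ) (E : ℕ → ℕ → M) : Prop where
  eq_zero : ∀ i j, n ≤ i ∨ t ≤ j → E i j = 0
  X_smul : ∀ i j, HopfOre.X χ a • E i j = E (i + 1) j + ω ^ i • E i (j + 1)
  of_smul : ∀ g i j, HopfOre.of χ a g • E i j = (((χ g) ^ (i + j) * μ g : kˣ) : k) • E i j
  span : ∀ S : Submodule k M, (∀ i j, E i j ∈ S) → S = ⊤

namespace IsGrid

variable {ω : k} {n t : ℕ} {E : ℕ → ℕ → M}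

theorem X_smul_realize (hE : IsGrid χ a μ ω n t E) {d : ℕ} {f : k[X]}
    (hf : f ∈ degreeLT k (d + 1)) :
    HopfOre.X χ a • realize E d f = realize E (d + 1) (qx ω f) := by
  have h1 : ∑ i ∈ Finset.range (d + 1), (ω ^ i * f.coeff i) • E i (d + 1 - i) =
      f.coeff 0 • E 0 (d + 1) +
      ∑ i ∈ Finset.range (d + 1), (ω ^ (i + 1) * f.coeff (i + 1)) • E (i + 1) (d - i) := by
    have h2 := Finset.sum_range_succ (fun i => (ω ^ i * f.coeff i) • E i (d + 1 - i)) (d + 1)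
    rw [mem_degreeLT_iff_coeff.1 hf (d + 1) le_rfl, mul_zero, zero_smul, add_zero] at h2
    rw [← h2, Finset.sum_range_succ', add_comm]
    simp
  rw [realize_apply E d, realize_apply, Finset.sum_range_succ' _ (d + 1), Finset.smul_sum]
  simp only [coeff_qx_succ, coeff_qx_zero, Nat.add_sub_add_right, Nat.sub_zero, add_smul,
    Finset.sum_add_distrib]
  rw [add_assoc, add_comm _ (f.coeff 0 • _), ← h1, ← Finset.sum_add_distrib]
  refine Finset.sum_congr rfl fun i hi => ?_
  have hi := Finset.mem_range.1 hi
  rw [smul_comm, hE.X_smul, smul_add, smul_smul, mul_comm (f.coeff i),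
    show d - i + 1 = d + 1 - i by omega]

theorem X_pow_smul_realize (hE : IsGrid χ a μ ω n t E) {d : ℕ} {f : k[X]}
    (hf : f ∈ degreeLT k (d + 1)) (c : ℕ) :
    HopfOre.X χ a ^ c • realize E d f = realize E (d + c) ((qx ω ^ c) f) := by
  induction c with
  | zero => simp
  | succ c ih =>
    rw [pow_succ', mul_smul, ih, hE.X_smul_realize
      (by convert qx_pow_mem_degreeLT ω hf c using 2; omega), pow_succ', Module.End.mul_apply,
      add_assoc]

theorem of_smul_realize (hE : IsGrid χ a μ ω n t E) (g : G) (d : ℕ) (f : k[X]) :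
    HopfOre.of χ a g • realize E d f = (((χ g) ^ d * μ g : kˣ) : k) • realize E d f := by
  rw [realize_apply, Finset.smul_sum, Finset.smul_sum]
  refine Finset.sum_congr rfl fun i hi => ?_
  have hi := Finset.mem_range.1 hi
  rw [smul_comm, hE.of_smul, show i + (d - i) = d by omega, smul_comm]

theorem exists_stringSystem (hE : IsGrid χ a μ ω n t E) {L : ℕ → ℕ}
    (hL : ∀ d < t, HasString ω n t d (L d)) : ∃ b, IsStringSystem χ a M μ t L b := by
  have h : ∀ d, ∃ b ∈ degreeLT k (d + 1), phi ω b ≠ 0 ∧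
      (d < t → (qx ω ^ L d) b ∈ box n t (d + L d)) ∧ (t ≤ d → realize E d b = 0) := by
    intro d
    rcases Nat.lt_or_ge d t with hd | hd
    · obtain ⟨b, h1, h2, h3⟩ := hL d hd
      exact ⟨b, h1, h2, fun _ => h3, fun h => absurd hd (not_lt.2 h)⟩
    · refine ⟨1, one_mem_degreeLT (by omega), by rw [phi_one]; exact one_ne_zero,
        fun h => absurd h (not_lt.2 hd), fun _ => ?_⟩
      rw [realize_one, hE.eq_zero _ _ (Or.inr hd)]
  -- in the degrees `d ≥ t`, where no string starts, `w^d` generates modulo `x` and maps to zero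
  choose B hB hphi hnil hzero using h
  refine ⟨fun d => realize E d (B d), fun d g => hE.of_smul_realize g d _, fun d hd => ?_,
    fun S hS => ?_⟩
  · rw [hE.X_pow_smul_realize (hB d), realize_eq_zero_of_mem_box hE.eq_zero (hnil d hd)]
  · have hS' : ∀ d, realize E d (B d) ∈ S := by
      intro d
      rcases Nat.lt_or_ge d t with hd | hd
      · exact hS d hd
      · rw [hzero d hd]; exact zero_mem _
    have hmem : ∀ d, ∀ f ∈ degreeLT k (d + 1), realize E d f ∈ S := by
      intro d
      induction d with
      | zero =>
        intro f hf
        obtain ⟨g, hg, hfg⟩ := exists_add_smul_of_phi_ne_zero (hB 0) (hphi 0) hf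
        obtain ⟨c, rfl⟩ := hfg
        rw [degreeLT_zero_eq hg, map_zero, zero_add, map_smul]
        exact S.smul_of_tower_mem c (hS' 0)
      | succ d ih =>
        intro f hf
        obtain ⟨g, hg, hfg⟩ := exists_add_smul_of_phi_ne_zero (hB (d + 1)) (hphi (d + 1)) hf
        obtain ⟨c, rfl⟩ := hfg
        rw [map_add, ← hE.X_smul_realize hg, map_smul]
        exact add_mem (S.smul_mem _ (ih g hg)) (S.smul_of_tower_mem c (hS' (d + 1)))
    have := hE.span (S.restrictScalars k) fun i j => by
      rw [Submodule.restrictScalars_mem, ← realize_X_pow (k := k) E i j]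
      refine hmem _ _ ?_
      rw [mem_degreeLT, degree_X_pow]; exact_mod_cast (by omega)
    rw [eq_top_iff]
    intro x _
    have hx : x ∈ S.restrictScalars k := by rw [this]; trivial
    exact hx

end IsGrid

end QuantumPlane

/-! ### The two tensor products -/

section Tensor

variable {k : Type u} {G : Type v} [Field k] [Group G] (χ : G →* kˣ) (a : Subgroup.center G)

namespace ModTensor

variable {χ a} {M N : Type w} [AddCommGroup M] [Module k M] [AddCommGroup N] [Module k N]

instance [Module.Finite k M] [Module.Finite k N] :
    Module.Finite k (ModTensor k (HopfOre χ a) M N) :=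
  inferInstanceAs (Module.Finite k (M ⊗[k] N))

theorem finrank_eq [Module.Free k M] [Module.Free k N] :
    Module.finrank k (ModTensor k (HopfOre χ a) M N) = Module.finrank k M * Module.finrank k N :=
  Module.finrank_tensorProduct (R := k) (S := k) (M := M) (M' := N)

theorem tmul_zero (m : M) : tmul k (HopfOre χ a) M N m 0 = 0 := TensorProduct.tmul_zero _ _

theorem zero_tmul (n : N) : tmul k (HopfOre χ a) M N 0 n = 0 := TensorProduct.zero_tmul _ _

theorem smul_tmul (c : k) (m : M) (n : N) :
    tmul k (HopfOre χ a) M N (c • m) n = c • tmul k (HopfOre χ a) M N m n :=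
  TensorProduct.smul_tmul' c m n

theorem tmul_smul (c : k) (m : M) (n : N) :
    tmul k (HopfOre χ a) M N m (c • n) = c • tmul k (HopfOre χ a) M N m n :=
  TensorProduct.tmul_smul c m n

theorem eq_top_of_tmul_mem {S : Submodule k (ModTensor k (HopfOre χ a) M N)} {A : Set M}
    {B : Set N} (hA : Submodule.span k A = ⊤) (hB : Submodule.span k B = ⊤)
    (h : ∀ m ∈ A, ∀ n ∈ B, tmul k (HopfOre χ a) M N m n ∈ S) : S = ⊤ := by
  have key : ∀ S : Submodule k (M ⊗[k] N), (∀ m ∈ A, ∀ n ∈ B, m ⊗ₜ[k] n ∈ S) → S = ⊤ := by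
    intro S h
    have h1 : Submodule.map₂ (TensorProduct.mk k M N) ⊤ ⊤ ≤ S := by
      rw [← hA, ← hB, Submodule.map₂_span_span, Submodule.span_le]
      rintro _ ⟨m, hm, n, hn, rfl⟩
      exact h m hm n hn
    rw [TensorProduct.map₂_mk_top_top_eq_top] at h1
    exact top_le_iff.1 h1
  exact key S h

end ModTensor

open NilMod QuantumPlane

/-- The rescaling of the basis `m_i ⊗ m_j` absorbs the scalars `σ(a) χ(a)^j` by which `a` acts on the
second factor. -/
theorem isGrid_tensor (n t : ℕ) (lam σ : G →* kˣ) :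
    IsGrid χ a (lam * σ) ((χ⁻¹ (a : G) : kˣ) : k) n t fun i j =>
      (((σ (a : G)) ^ i * (χ (a : G)) ^ (i * j) : kˣ) : k) •
        ModTensor.tmul k (HopfOre χ a) (NilMod χ a n lam) (NilMod χ a t σ)
          (vec χ a n lam i) (vec χ a t σ j) where
  eq_zero i j h := by
    rcases h with h | h
    · rw [vec_of_le _ _ _ _ h, ModTensor.zero_tmul, smul_zero]
    · rw [vec_of_le _ _ _ _ h, ModTensor.tmul_zero, smul_zero]
  X_smul i j := by
    rw [smul_comm, HopfOre.X_smul_tmul, X_smul_vec, X_smul_vec, of_smul_vec, ModTensor.tmul_smul,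
      smul_add, smul_smul, smul_smul, ← Units.val_mul, ← Units.val_pow_eq_pow_val, ← Units.val_mul,
      MonoidHom.inv_apply]
    congr 3
    · rw [show (i + 1) * j = i * j + j by ring, pow_succ, pow_add]; ac_rfl
    · rw [show i * (j + 1) = i * j + i by ring, pow_add, inv_pow, eq_inv_mul_iff_mul_eq]; ac_rfl
  of_smul g i j := by
    rw [smul_comm, HopfOre.of_smul_tmul, of_smul_vec, of_smul_vec, ModTensor.tmul_smul,
      ModTensor.smul_tmul, smul_smul, smul_smul, smul_smul, MonoidHom.mul_apply]
    push_cast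
    congr 1
    ring
  span S hS := by
    refine ModTensor.eq_top_of_tmul_mem (span_vec χ a n lam) (span_vec χ a t σ) ?_
    rintro _ ⟨i, rfl⟩ _ ⟨j, rfl⟩
    exact (S.smul_mem_iff (Units.ne_zero _)).1 (hS i j)

/-- For the opposite order of the factors the quantum parameter is inverted. -/
theorem isGrid_tensor_swap (n t : ℕ) (lam σ : G →* kˣ) :
    IsGrid χ a (lam * σ) ((χ (a : G) : kˣ) : k) n t fun i j =>
      (((lam (a : G)) ^ j : kˣ) : k) •
        ModTensor.tmul k (HopfOre χ a) (NilMod χ a t σ) (NilMod χ a n lam)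
          (vec χ a t σ j) (vec χ a n lam i) where
  eq_zero i j h := by
    rcases h with h | h
    · rw [vec_of_le _ _ _ _ h, ModTensor.tmul_zero, smul_zero]
    · rw [vec_of_le _ _ _ _ h, ModTensor.zero_tmul, smul_zero]
  X_smul i j := by
    rw [smul_comm, HopfOre.X_smul_tmul, X_smul_vec, X_smul_vec, of_smul_vec, ModTensor.tmul_smul,
      smul_add, smul_smul, smul_smul, ← Units.val_mul, ← Units.val_pow_eq_pow_val, ← Units.val_mul,
      add_comm]
    congr 3
    rw [pow_succ, mul_left_comm]
  of_smul g i j := by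
    rw [smul_comm, HopfOre.of_smul_tmul, of_smul_vec, of_smul_vec, ModTensor.tmul_smul,
      ModTensor.smul_tmul, smul_smul, smul_smul, smul_smul, MonoidHom.mul_apply]
    push_cast
    congr 1
    ring
  span S hS := by
    refine ModTensor.eq_top_of_tmul_mem (span_vec χ a t σ) (span_vec χ a n lam) ?_
    rintro _ ⟨j, rfl⟩ _ ⟨i, rfl⟩
    exact (S.smul_mem_iff (Units.ne_zero _)).1 (hS i j)

end Tensor

/-! ### Counting dimensions -/

theorem sum_Ico_sub_two_mul (A : ℤ) {p q : ℕ} (h : p ≤ q) :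
    ∑ j ∈ Finset.Ico p q, (A - 2 * j) = (q - p : ℤ) * (A - q - p + 1) := by
  induction q, h using Nat.le_induction with
  | base => simp
  | succ q _ ih => rw [Finset.sum_Ico_succ_top (by omega), ih]; push_cast; ring

theorem sum_range_sub_two_mul (A B : ℤ) (m : ℕ) :
    ∑ i ∈ Finset.range m, (A - 2 * i * B) = m * (A - (m - 1) * B) := by
  induction m with
  | zero => simp
  | succ m ih => rw [Finset.sum_range_succ, ih]; push_cast; ring

theorem sum_paired {A s m p q : ℕ} (hpq : p ≤ q) (h : ∀ i < m, ∀ j < q, 2 * i * s + 2 * j ≤ A) :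
    ((∑ i ∈ Finset.range m, ∑ j ∈ Finset.Ico p q, (A - 2 * i * s - 2 * j) : ℕ) : ℤ) =
      m * (q - p) * (A - (m - 1) * s - q - p + 1) := by
  rw [Nat.cast_sum]
  have h1 : ∀ i ∈ Finset.range m, ((∑ j ∈ Finset.Ico p q, (A - 2 * i * s - 2 * j) : ℕ) : ℤ) =
      (q - p) * (A - q - p + 1) - 2 * i * ((q - p) * s) := by
    intro i hi
    have h2 : ∀ j ∈ Finset.Ico p q, ((A - 2 * i * s - 2 * j : ℕ) : ℤ) =
        ((A : ℤ) - 2 * i * s) - 2 * j := by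
      intro j hj
      have := h i (Finset.mem_range.1 hi) j (Finset.mem_Ico.1 hj).2
      rw [Nat.sub_sub, Nat.cast_sub this]; push_cast; ring
    rw [Nat.cast_sum, Finset.sum_congr rfl h2, sum_Ico_sub_two_mul _ hpq]
    ring
  rw [Finset.sum_congr rfl h1, sum_range_sub_two_mul]
  ring

theorem sum_multiple {A s m p q : ℕ} (hpq : p ≤ q) (h : ∀ i < m, 2 * i ≤ A) :
    ((∑ i ∈ Finset.range m, ∑ _j ∈ Finset.Ico p q, (A - 2 * i) * s : ℕ) : ℤ) =
      m * (q - p) * s * (A - (m - 1)) := by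
  have h1 : ∀ i ∈ Finset.range m, ((∑ _j ∈ Finset.Ico p q, (A - 2 * i) * s : ℕ) : ℤ) =
      (q - p) * s * A - 2 * i * ((q - p) * s) := by
    intro i hi
    have := h i (Finset.mem_range.1 hi)
    rw [Finset.sum_const, Nat.card_Ico, smul_eq_mul, Nat.cast_mul, Nat.cast_mul, Nat.cast_sub this,
      Nat.cast_sub hpq]
    push_cast; ring
  rw [Nat.cast_sum, Finset.sum_congr rfl h1, sum_range_sub_two_mul]
  ring

/-! ### The decomposition -/
section Decomposition

variable {k : Type u} {G : Type v} [Field k] [Group G] {χ : G →* kˣ} {a : Subgroup.center G}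
  {M : Type w} [AddCommGroup M] [Module k M] [Module (HopfOre χ a) M]
  [IsScalarTower k (HopfOre χ a) M] {μ : G →* kˣ}

open QuantumPlane

variable (χ a M μ) in
/-- `M` is isomorphic to the direct sums listed for the four relative positions of `l`, `l'` and `s`,
with `μ` in the role of the product of the two characters. -/
def HasDecomposition (s n t r r' l l' : ℕ) : Prop :=
    (l + l' ≤ s → l ≤ l' →
      Nonempty (M ≃ₗ[HopfOre χ a]
        NilSum χ a μ (Finset.range (r + 1)) (Finset.range l)
            (fun i j => n + t - 1 - 2 * i * s - 2 * j) ×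
          NilSum χ a μ (Finset.range r) (Finset.Ico l l')
            (fun i _ => (r + r' - 2 * i) * s) ×
          NilSum χ a μ (Finset.range r) (Finset.Ico l' (l + l'))
            (fun i j => n + t - 1 - 2 * i * s - 2 * j) ×
          NilSum χ a μ (Finset.range r) (Finset.Ico (l + l') s)
            (fun i _ => (r + r' - 1 - 2 * i) * s))) ∧
    (l + l' ≤ s → l' ≤ l →
      Nonempty (M ≃ₗ[HopfOre χ a]
        NilSum χ a μ (Finset.range (r + 1)) (Finset.range l')
            (fun i j => n + t - 1 - 2 * i * s - 2 * j) ×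
          NilSum χ a μ (Finset.range (r + 1)) (Finset.Ico l' l)
            (fun i _ => (r + r' - 2 * i) * s) ×
          NilSum χ a μ (Finset.range r) (Finset.Ico l (l + l'))
            (fun i j => n + t - 1 - 2 * i * s - 2 * j) ×
          NilSum χ a μ (Finset.range r) (Finset.Ico (l + l') s)
            (fun i _ => (r + r' - 1 - 2 * i) * s))) ∧
    (∀ m : ℕ, l + l' = s + 1 + m → l ≤ l' →
      Nonempty (M ≃ₗ[HopfOre χ a]
        NilSum χ a μ (Finset.range (r + 1)) (Finset.range (m + 1))
            (fun i _ => (r + r' + 1 - 2 * i) * s) ×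
          NilSum χ a μ (Finset.range (r + 1)) (Finset.Ico (m + 1) l)
            (fun i j => n + t - 1 - 2 * i * s - 2 * j) ×
          NilSum χ a μ (Finset.range r) (Finset.Ico l l')
            (fun i _ => (r + r' - 2 * i) * s) ×
          NilSum χ a μ (Finset.range r) (Finset.Ico l' s)
            (fun i j => n + t - 1 - 2 * i * s - 2 * j))) ∧
    (∀ m : ℕ, l + l' = s + 1 + m → l' ≤ l →
      Nonempty (M ≃ₗ[HopfOre χ a]
        NilSum χ a μ (Finset.range (r + 1)) (Finset.range (m + 1))
            (fun i _ => (r + r' + 1 - 2 * i) * s) ×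
          NilSum χ a μ (Finset.range (r + 1)) (Finset.Ico (m + 1) l')
            (fun i j => n + t - 1 - 2 * i * s - 2 * j) ×
          NilSum χ a μ (Finset.range (r + 1)) (Finset.Ico l' l)
            (fun i _ => (r + r' - 2 * i) * s) ×
          NilSum χ a μ (Finset.range r) (Finset.Ico l s)
            (fun i j => n + t - 1 - 2 * i * s - 2 * j)))

theorem stringLength_div_mod {s r r' l l' i j : ℕ} (hj : j < s) :
    stringLength s r r' l l' ((i * s + j) / s) ((i * s + j) % s) = stringLength s r r' l l' i j := by
  have h1 : (i * s + j) / s = i := by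
    rw [add_comm, Nat.add_mul_div_right _ _ (by omega), Nat.div_eq_of_lt hj, zero_add]
  have h2 : (i * s + j) % s = j := by
    rw [add_comm, Nat.add_mul_mod_self_right, Nat.mod_eq_of_lt hj]
  rw [h1, h2]

theorem IsStringSystem.hasDecomposition [Module.Finite k M] {s n t r r' l l' : ℕ} {b : ℕ → M}
    (hb : IsStringSystem χ a M μ t
      (fun d => stringLength s r r' l l' (d / s) (d % s)) b)
    (hs : 0 < s) (hχ : χ ^ s = 1) (hrank : Module.finrank k M = n * t)
    (hl : l < s) (hl' : l' < s) (ht0 : 1 ≤ t) (htn : t ≤ n) (hn : n = r' * s + l')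
    (ht : t = r * s + l) :
    HasDecomposition χ a M μ s n t r r' l l' := by
  have hlex : ∀ {a b x y : ℕ}, a * s + x ≤ b * s + y → y < s → a ≤ b := by
    intro a b x y h hy
    by_contra hc
    have : (b + 1) * s ≤ a * s := Nat.mul_le_mul_right s (by omega)
    rw [add_mul] at this; omega
  have hlt : ∀ {a b x : ℕ}, a * s + x < b * s → a < b := by
    intro a b x h
    exact lt_of_mul_lt_mul_right (by omega : a * s < b * s) (Nat.zero_le s)
  have hrr : r ≤ r' := hlex (by omega : r * s + l ≤ r' * s + l') hl'
  have hrs : r * s ≤ r' * s := Nat.mul_le_mul_right s hrr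
  have hrr1 : l' < l → r < r' := fun h => hlt (x := l - l' - 1) (by omega)
  have hle : ∀ {i}, i ≤ r → i * s ≤ r * s := fun h => Nat.mul_le_mul_right s h
  have hlt1 : ∀ {i}, i < r → i * s + s ≤ r * s := fun {i} h => by
    have : (i + 1) * s ≤ r * s := Nat.mul_le_mul_right s h
    rwa [add_mul, one_mul] at this
  have h2 : ∀ i, 2 * i * s = 2 * (i * s) := fun i => mul_assoc _ _ _
  have hcover : ∀ d < t, ∃ i j, d = i * s + j ∧ j < s ∧ i < r + 1 ∧ (l ≤ j → i < r) := by
    intro d hd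
    have hd' : d / s * s + d % s = d := Nat.div_add_mod' d s
    refine ⟨d / s, d % s, hd'.symm, Nat.mod_lt d hs, ?_, fun h => hlt (x := d % s - l) (by omega)⟩
    have := hlex (by omega : d / s * s + d % s ≤ r * s + l) hl
    omega
  have block : ∀ {m p q : ℕ} {d : ℕ → ℕ → ℕ}, q ≤ s → (m = r ∨ m = r + 1 ∧ q ≤ l) →
      (∀ i < m, ∀ j, p ≤ j → j < q → d i j = stringLength s r r' l l' i j) →
      IsStringBlock s t (fun d => stringLength s r r' l l' (d / s) (d % s))
        (Finset.range m) (Finset.Ico p q) d := by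
    intro m p q d hq hm hd i hi j hj
    rw [Finset.mem_range] at hi
    rw [Finset.mem_Ico] at hj
    refine ⟨?_, ?_⟩
    · rcases hm with rfl | ⟨rfl, hm⟩
      · have := hlt1 hi; omega
      · have := hle (Nat.lt_succ_iff.1 hi); omega
    · rw [hd i hi j hj.1 hj.2]
      exact (stringLength_div_mod (by omega)).symm
  have hA : ((n + t - 1 : ℕ) : ℤ) = n + t - 1 := by omega
  -- `r + r' - 1` is truncated when `r = r' = 0`, but then it is multiplied by `r`
  have hA' : (r : ℤ) * ((r + r' - 1 : ℕ) : ℤ) = r * (r + r' - 1) := by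
    rcases Nat.eq_zero_or_pos r with h0 | h0
    · simp [h0]
    · rw [show ((r + r' - 1 : ℕ) : ℤ) = r + r' - 1 by omega]
  have hnZ : (n : ℤ) = r' * s + l' := by exact_mod_cast hn
  have htZ : (t : ℤ) = r * s + l := by exact_mod_cast ht
  refine ⟨fun h h' => ?_, fun h h' => ?_, fun m h h' => ?_, fun m h h' => ?_⟩
  · rw [Finset.range_eq_Ico (l)]
    refine hb.nonempty_equiv hχ (block (by omega) (by omega) ?_) (block (by omega) (by omega) ?_)
      (block (by omega) (by omega) ?_) (block (by omega) (by omega) ?_) ?_ ?_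
    · intro i hi j hj1 hj2
      rw [stringLength, if_neg (by omega), if_pos (by omega), hn, ht]
    · intro i hi j hj1 hj2
      rw [stringLength, if_neg (by omega), if_neg (by omega), if_pos (by omega)]
    · intro i hi j hj1 hj2
      rw [stringLength, if_neg (by omega), if_neg (by omega), if_neg (by omega), if_pos (by omega), hn, ht]
    · intro i hi j hj1 hj2
      rw [stringLength, if_neg (by omega), if_neg (by omega), if_neg (by omega), if_neg (by omega)]
    · intro d hd
      obtain ⟨i, j, hij, hj, hi, hi'⟩ := hcover d hd
      refine ⟨i, j, hij, ?_⟩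
      simp only [Finset.mem_range, Finset.mem_Ico]
      omega
    · rw [hrank]
      apply Nat.cast_injective (R := ℤ)
      have e0 := sum_paired (A := n + t - 1) (s := s) (m := r + 1) (p := 0) (q := l) (by omega) (by
        intro i hi j hj; have := hle (Nat.lt_succ_iff.1 hi); rw [h2]; omega)
      have e1 := sum_multiple (A := r + r') (s := s) (m := r) (p := l) (q := l') (by omega)
        (by omega)
      have e2 := sum_paired (A := n + t - 1) (s := s) (m := r) (p := l') (q := l + l') (by omega) (by
        intro i hi j hj; have := hlt1 hi; rw [h2]; omega)
      have e3 := sum_multiple (A := r + r' - 1) (s := s) (m := r) (p := l + l') (q := s) (by omega)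
        (by omega)
      rw [Nat.cast_add, Nat.cast_add, Nat.cast_add, Nat.cast_mul n t, e0, e1, e2, e3]
      push_cast [hA]
      rw [hnZ, htZ]
      linear_combination (s - l - l') * s * hA'
  · rw [Finset.range_eq_Ico (l')]
    refine hb.nonempty_equiv hχ (block (by omega) (by omega) ?_) (block (by omega) (by omega) ?_)
      (block (by omega) (by omega) ?_) (block (by omega) (by omega) ?_) ?_ ?_
    · intro i hi j hj1 hj2
      rw [stringLength, if_neg (by omega), if_pos (by omega), hn, ht]
    · intro i hi j hj1 hj2
      rw [stringLength, if_neg (by omega), if_neg (by omega), if_pos (by omega)]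
    · intro i hi j hj1 hj2
      rw [stringLength, if_neg (by omega), if_neg (by omega), if_neg (by omega), if_pos (by omega), hn, ht]
    · intro i hi j hj1 hj2
      rw [stringLength, if_neg (by omega), if_neg (by omega), if_neg (by omega), if_neg (by omega)]
    · intro d hd
      obtain ⟨i, j, hij, hj, hi, hi'⟩ := hcover d hd
      refine ⟨i, j, hij, ?_⟩
      simp only [Finset.mem_range, Finset.mem_Ico]
      omega
    · rw [hrank]
      apply Nat.cast_injective (R := ℤ)
      have e0 := sum_paired (A := n + t - 1) (s := s) (m := r + 1) (p := 0) (q := l') (by omega) (by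
        intro i hi j hj; have := hle (Nat.lt_succ_iff.1 hi); rw [h2]; omega)
      have e1 := sum_multiple (A := r + r') (s := s) (m := r + 1) (p := l') (q := l) (by omega)
        (by omega)
      have e2 := sum_paired (A := n + t - 1) (s := s) (m := r) (p := l) (q := l + l') (by omega) (by
        intro i hi j hj; have := hlt1 hi; rw [h2]; omega)
      have e3 := sum_multiple (A := r + r' - 1) (s := s) (m := r) (p := l + l') (q := s) (by omega)
        (by omega)
      rw [Nat.cast_add, Nat.cast_add, Nat.cast_add, Nat.cast_mul n t, e0, e1, e2, e3]
      push_cast [hA]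
      rw [hnZ, htZ]
      linear_combination (s - l - l') * s * hA'
  · rw [Finset.range_eq_Ico (m + 1)]
    refine hb.nonempty_equiv hχ (block (by omega) (by omega) ?_) (block (by omega) (by omega) ?_)
      (block (by omega) (by omega) ?_) (block (by omega) (by omega) ?_) ?_ ?_
    · intro i hi j hj1 hj2
      rw [stringLength, if_pos (by omega)]
    · intro i hi j hj1 hj2
      rw [stringLength, if_neg (by omega), if_pos (by omega), hn, ht]
    · intro i hi j hj1 hj2
      rw [stringLength, if_neg (by omega), if_neg (by omega), if_pos (by omega)]
    · intro i hi j hj1 hj2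
      rw [stringLength, if_neg (by omega), if_neg (by omega), if_neg (by omega), if_pos (by omega), hn, ht]
    · intro d hd
      obtain ⟨i, j, hij, hj, hi, hi'⟩ := hcover d hd
      refine ⟨i, j, hij, ?_⟩
      simp only [Finset.mem_range, Finset.mem_Ico]
      omega
    · rw [hrank]
      apply Nat.cast_injective (R := ℤ)
      have e0 := sum_multiple (A := r + r' + 1) (s := s) (m := r + 1) (p := 0) (q := m + 1) (by omega)
        (by omega)
      have e1 := sum_paired (A := n + t - 1) (s := s) (m := r + 1) (p := m + 1) (q := l) (by omega) (by
        intro i hi j hj; have := hle (Nat.lt_succ_iff.1 hi); rw [h2]; omega)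
      have e2 := sum_multiple (A := r + r') (s := s) (m := r) (p := l) (q := l') (by omega)
        (by omega)
      have e3 := sum_paired (A := n + t - 1) (s := s) (m := r) (p := l') (q := s) (by omega) (by
        intro i hi j hj; have := hlt1 hi; rw [h2]; omega)
      rw [Nat.cast_add, Nat.cast_add, Nat.cast_add, Nat.cast_mul n t, e0, e1, e2, e3]
      have hm : (m : ℤ) = l + l' - s - 1 := by omega
      push_cast [hA]
      rw [hnZ, htZ]
      rw [hm]
      ring
  · rw [Finset.range_eq_Ico (m + 1)]
    refine hb.nonempty_equiv hχ (block (by omega) (by omega) ?_) (block (by omega) (by omega) ?_)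
      (block (by omega) (by omega) ?_) (block (by omega) (by omega) ?_) ?_ ?_
    · intro i hi j hj1 hj2
      rw [stringLength, if_pos (by omega)]
    · intro i hi j hj1 hj2
      rw [stringLength, if_neg (by omega), if_pos (by omega), hn, ht]
    · intro i hi j hj1 hj2
      rw [stringLength, if_neg (by omega), if_neg (by omega), if_pos (by omega)]
    · intro i hi j hj1 hj2
      rw [stringLength, if_neg (by omega), if_neg (by omega), if_neg (by omega), if_pos (by omega), hn, ht]
    · intro d hd
      obtain ⟨i, j, hij, hj, hi, hi'⟩ := hcover d hd
      refine ⟨i, j, hij, ?_⟩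
      simp only [Finset.mem_range, Finset.mem_Ico]
      omega
    · rw [hrank]
      apply Nat.cast_injective (R := ℤ)
      have e0 := sum_multiple (A := r + r' + 1) (s := s) (m := r + 1) (p := 0) (q := m + 1) (by omega)
        (by omega)
      have e1 := sum_paired (A := n + t - 1) (s := s) (m := r + 1) (p := m + 1) (q := l') (by omega) (by
        intro i hi j hj; have := hle (Nat.lt_succ_iff.1 hi); rw [h2]; omega)
      have e2 := sum_multiple (A := r + r') (s := s) (m := r + 1) (p := l') (q := l) (by omega)
        (by omega)
      have e3 := sum_paired (A := n + t - 1) (s := s) (m := r) (p := l) (q := s) (by omega) (by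
        intro i hi j hj; have := hlt1 hi; rw [h2]; omega)
      rw [Nat.cast_add, Nat.cast_add, Nat.cast_add, Nat.cast_mul n t, e0, e1, e2, e3]
      have hm : (m : ℤ) = l + l' - s - 1 := by omega
      push_cast [hA]
      rw [hnZ, htZ]
      rw [hm]
      ring

end Decomposition

theorem theorem3p15 {k : Type*} {G : Type*} [Field k] [IsAlgClosed k] [CharZero k] [Group G]
    (χ : G →* kˣ) (a : Subgroup.center G) (hχa : χ a ≠ 1)
    (s : ℕ) (hs : 0 < s) (hχ : orderOf χ = s)
    (hq : IsPrimitiveRoot ((χ⁻¹ (a : G) : kˣ) : k) s)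
    (lam σ : G →* kˣ) (n t r r' l l' : ℕ) (ht : 1 ≤ t) (htn : t ≤ n)
    (hl : l < s) (hl' : l' < s) (hn : n = r' * s + l') (htr : t = r * s + l) :
    Nonempty (ModTensor k (HopfOre χ a) (NilMod χ a n lam) (NilMod χ a t σ) ≃ₗ[HopfOre χ a]
      ModTensor k (HopfOre χ a) (NilMod χ a t σ) (NilMod χ a n lam)) ∧
    (l + l' ≤ s → l ≤ l' →
      Nonempty (ModTensor k (HopfOre χ a) (NilMod χ a n lam) (NilMod χ a t σ) ≃ₗ[HopfOre χ a]
        NilSum χ a (lam * σ) (Finset.range (r + 1)) (Finset.range l)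
            (fun i j => n + t - 1 - 2 * i * s - 2 * j) ×
          NilSum χ a (lam * σ) (Finset.range r) (Finset.Ico l l')
            (fun i _ => (r + r' - 2 * i) * s) ×
          NilSum χ a (lam * σ) (Finset.range r) (Finset.Ico l' (l + l'))
            (fun i j => n + t - 1 - 2 * i * s - 2 * j) ×
          NilSum χ a (lam * σ) (Finset.range r) (Finset.Ico (l + l') s)
            (fun i _ => (r + r' - 1 - 2 * i) * s))) ∧
    (l + l' ≤ s → l' ≤ l →
      Nonempty (ModTensor k (HopfOre χ a) (NilMod χ a n lam) (NilMod χ a t σ) ≃ₗ[HopfOre χ a]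
        NilSum χ a (lam * σ) (Finset.range (r + 1)) (Finset.range l')
            (fun i j => n + t - 1 - 2 * i * s - 2 * j) ×
          NilSum χ a (lam * σ) (Finset.range (r + 1)) (Finset.Ico l' l)
            (fun i _ => (r + r' - 2 * i) * s) ×
          NilSum χ a (lam * σ) (Finset.range r) (Finset.Ico l (l + l'))
            (fun i j => n + t - 1 - 2 * i * s - 2 * j) ×
          NilSum χ a (lam * σ) (Finset.range r) (Finset.Ico (l + l') s)
            (fun i _ => (r + r' - 1 - 2 * i) * s))) ∧
    (∀ m : ℕ, l + l' = s + 1 + m → l ≤ l' →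
      Nonempty (ModTensor k (HopfOre χ a) (NilMod χ a n lam) (NilMod χ a t σ) ≃ₗ[HopfOre χ a]
        NilSum χ a (lam * σ) (Finset.range (r + 1)) (Finset.range (m + 1))
            (fun i _ => (r + r' + 1 - 2 * i) * s) ×
          NilSum χ a (lam * σ) (Finset.range (r + 1)) (Finset.Ico (m + 1) l)
            (fun i j => n + t - 1 - 2 * i * s - 2 * j) ×
          NilSum χ a (lam * σ) (Finset.range r) (Finset.Ico l l')
            (fun i _ => (r + r' - 2 * i) * s) ×
          NilSum χ a (lam * σ) (Finset.range r) (Finset.Ico l' s)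
            (fun i j => n + t - 1 - 2 * i * s - 2 * j))) ∧
    (∀ m : ℕ, l + l' = s + 1 + m → l' ≤ l →
      Nonempty (ModTensor k (HopfOre χ a) (NilMod χ a n lam) (NilMod χ a t σ) ≃ₗ[HopfOre χ a]
        NilSum χ a (lam * σ) (Finset.range (r + 1)) (Finset.range (m + 1))
            (fun i _ => (r + r' + 1 - 2 * i) * s) ×
          NilSum χ a (lam * σ) (Finset.range (r + 1)) (Finset.Ico (m + 1) l')
            (fun i j => n + t - 1 - 2 * i * s - 2 * j) ×
          NilSum χ a (lam * σ) (Finset.range (r + 1)) (Finset.Ico l' l)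
            (fun i _ => (r + r' - 2 * i) * s) ×
          NilSum χ a (lam * σ) (Finset.range r) (Finset.Ico l s)
            (fun i j => n + t - 1 - 2 * i * s - 2 * j))) := by
  have hχs : χ ^ s = 1 := by rw [← hχ]; exact pow_orderOf_eq_one χ
  have hq' : IsPrimitiveRoot ((χ (a : G) : kˣ) : k) s := by
    have := hq.inv
    simpa using this
  have key : ∀ {ω : k}, IsPrimitiveRoot ω s → ∀ d < t,
      QuantumPlane.HasString ω n t d
        (QuantumPlane.stringLength s r r' l l' (d / s) (d % s)) := by
    intro ω hω d hd
    have hd' : d / s * s + d % s = d := Nat.div_add_mod' d s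
    have := QuantumPlane.hasString_stringLength hω hs (r := r) (r' := r') (l := l) (l' := l') (i := d / s)
      (j := d % s) hl hl' (by omega) (Nat.mod_lt d hs) (by omega)
    rwa [hd', ← hn, ← htr] at this
  obtain ⟨b₁, hb₁⟩ := (isGrid_tensor χ a n t lam σ).exists_stringSystem (key hq)
  obtain ⟨b₂, hb₂⟩ := (isGrid_tensor_swap χ a n t lam σ).exists_stringSystem (key hq')
  have h₁ := hb₁.hasDecomposition (n := n) hs hχs
    (by rw [ModTensor.finrank_eq, NilMod.finrank_eq, NilMod.finrank_eq]) hl hl' ht htn hn htr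
  have h₂ := hb₂.hasDecomposition (n := n) hs hχs
    (by rw [ModTensor.finrank_eq, NilMod.finrank_eq, NilMod.finrank_eq, mul_comm])
    hl hl' ht htn hn htr
  refine ⟨?_, h₁⟩
  rcases Nat.lt_or_ge s (l + l') with h | h
  · obtain ⟨m, hm⟩ := Nat.exists_eq_add_of_lt h
    rcases le_total l l' with h' | h'
    · obtain ⟨e₁⟩ := h₁.2.2.1 m (by omega) h'
      obtain ⟨e₂⟩ := h₂.2.2.1 m (by omega) h'
      exact ⟨e₁.trans e₂.symm⟩
    · obtain ⟨e₁⟩ := h₁.2.2.2 m (by omega) h'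
      obtain ⟨e₂⟩ := h₂.2.2.2 m (by omega) h'
      exact ⟨e₁.trans e₂.symm⟩
  · rcases le_total l l' with h' | h'
    · obtain ⟨e₁⟩ := h₁.1 h h'
      obtain ⟨e₂⟩ := h₂.1 h h'
      exact ⟨e₁.trans e₂.symm⟩
    · obtain ⟨e₁⟩ := h₁.2.1 h h'
      obtain ⟨e₂⟩ := h₂.2.1 h h'
      exact ⟨e₁.trans e₂.symm⟩

end
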